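/- Let $H$ be an infinite-dimensional complex Hilbert space, $L$ a self-adjoint, strictly positive operator in $H$ with compact resolvent, and $\alpha,\beta>0$. Put $$C_1=27-18\tfrac{\beta}{\alpha}-\left(\tfrac{\beta}{\alpha}\right)^2,\quad C_2=C_1^2-64\left(\tfrac{\beta}{\alpha}\right)^3,\quad m_1=\alpha\,\frac{-C_1-\sqrt{C_2}}{8\beta^3},\quad m_2=\alpha\,\frac{-C_1+\sqrt{C_2}}{8\beta^3}$$ (non-real numbers if $C_2<0$). For $i=1,\dots,4$ let $\mathcal H_i=D(L^{k_1/2})\times D(L^{k_2/2})\times D(L^{k_3/2})$ with $(k_1,k_2,k_3)=(1,1,0),(2,2,1),(2,1,0),(3,2,1)$ respectively, with the natural scalar product, in which $D(L^{k/2})$ carries $\langle L^{k/2}u,L^{k/2}v\rangle$. Let $$A(u,v,w)=\left(v,\ w,\ -\tfrac1\alpha L(u+\beta v)-\tfrac1\alpha w\right)$$ in $\mathcal H_i$, with domain the set of all $(u,v,w)\in\mathcal H_i$ with $u+\beta v\in D(L)$ and $A(u,v,w)\in\mathcal H_i$ (the generator of $(u+\alpha u_t)_{tt}+L(u+\beta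 u_t)=0$). (i) Suppose that no eigenvalue of $L$ equals $m_1$ or $m_2$. Then there are an orthonormal basis $(\phi_n)_{n\ge1}$ of $H$ of eigenvectors of $L$, $L\phi_n=\mu_n\phi_n$ with $0<\mu_1\le\mu_2\le\dots\to\infty$, and, for each $n$, an enumeration $\lambda^n_1,\lambda^n_2,\lambda^n_3$ of the roots of $\alpha\lambda^3+\lambda^2+\beta\mu_n\lambda+\mu_n=0$ such that the following holds for $i=1,\dots,4$. Let $c^{n,i}_j=\left(\mu_n^{k_1}+\mu_n^{k_2}|\lambda^n_j|^2+\mu_n^{k_3}|\lambda^n_j|^4\right)^{1/2}$, let $C_{n,i}$ be the matrix with columns $(1,\lambda^n_j,(\lambda^n_j)^2)^T/c^{n,i}_j$, $j=1,2,3$, and $G_{n,i}=(C_{n,i}^{-1})^*C_{n,i}^{-1}$. Then $$\langle U,V\rangle_{G_i}=\sum_{n\ge1}\overline{U_n}^{\,T}G_{n,i}V_n,\qquad U_n=(\langle\phi_n,u\rangle,\langle\phi_n,v\rangle,\langle\phi_n,w\rangle)^T\ \text{ for } U=(u,v,w)$$ (scalar products are conjugate linear in the first argument), converges and defines a scalar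 product on $\mathcal H_i$ whose norm is equivalent to the natural one. In this scalar product $A$ is a normal operator: it is densely defined, $D(A)=D(A^*)$ and $\|AU\|=\|A^*U\|$ on this domain, and $A^*A=AA^*$ with equal domains. The vectors $\Psi^{n,i}_j=(\phi_n,\lambda^n_j\phi_n,(\lambda^n_j)^2\phi_n)/c^{n,i}_j$, $j=1,2,3$, $n\ge1$, satisfy $A\Psi^{n,i}_j=\lambda^n_j\Psi^{n,i}_j$, are orthonormal for $\langle\cdot,\cdot\rangle_{G_i}$, and are complete (their linear span is dense) in $\mathcal H_i$. (ii) Conversely, if some eigenvalue of $L$ equals $m_1$ or $m_2$ (including the case $m_1=m_2$), then for each $i=1,\dots,4$ there is no scalar product on $\mathcal H_i$ in which $A$ is a normal operator (densely defined, with $D(A)=D(A^*)$ and $\|AU\|=\|A^*U\|$ on this domain). -/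

import Mathlib

open Filter Topology
open scoped Matrix

noncomputable section

namespace ThirdOrderWave

section Operator

variable {H : Type*} [NormedAddCommGroup H] [InnerProductSpace ℂ H]

/-- `L` has compact resolvent: for some `z` the operator `L - z` is a bijection from the domain of
`L` onto `H` whose inverse `R` is a compact bounded operator. -/
def HasCompactResolvent (L : H →ₗ.[ℂ] H) : Prop :=
  ∃ (z : ℂ) (R : H →L[ℂ] H), IsCompactOperator R ∧
    (∀ y : H, ∃ h : R y ∈ L.domain, L ⟨R y, h⟩ - z • R y = y) ∧
    ∀ x : L.domain, R (L x - z • (x : H)) = x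

/-- The eigenspace `ker (L - μ)`. -/
def eigenspace (L : H →ₗ.[ℂ] H) (μ : ℝ) : Submodule ℂ H where
  carrier := {x | ∃ h : x ∈ L.domain, L ⟨x, h⟩ = (μ : ℂ) • x}
  add_mem' := by
    rintro x y ⟨hx, hx'⟩ ⟨hy, hy'⟩
    refine ⟨L.domain.add_mem hx hy, ?_⟩
    have := L.map_add ⟨x, hx⟩ ⟨y, hy⟩
    rw [hx', hy', ← smul_add] at this
    exact this
  zero_mem' := ⟨L.domain.zero_mem, by
    have := L.map_zero
    rw [smul_zero]
    exact this⟩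
  smul_mem' := by
    rintro c x ⟨hx, hx'⟩
    refine ⟨L.domain.smul_mem c hx, ?_⟩
    have := L.map_smul c ⟨x, hx⟩
    rw [hx', smul_comm] at this
    exact this

def IsEigenvalue (L : H →ₗ.[ℂ] H) (μ : ℝ) : Prop := ∃ x ∈ eigenspace L μ, x ≠ 0

variable [CompleteSpace H]

/-- The spectral projection of `L` at `μ`: the orthogonal projection onto the (closed) eigenspace
of `μ`; it vanishes if `μ` is not an eigenvalue. -/
def specProj (L : H →ₗ.[ℂ] H) (μ : ℝ) : H →L[ℂ] H :=
  (eigenspace L μ).topologicalClosure.starProjection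

/-- The domain `D(L^{k/2})`, by the functional calculus of a positive operator with compact
resolvent, `L^{k/2} u = ∑_μ μ^{k/2} P_μ u`, the sum being over the eigenvalues `μ` of `L` and `P_μ`
being the spectral projections (all other real `μ` contribute `0`). -/
def powDomain (L : H →ₗ.[ℂ] H) (k : ℕ) : Submodule ℂ H where
  carrier := {u | Summable fun μ : ℝ => |μ| ^ k * ‖specProj L μ u‖ ^ 2}
  add_mem' := by
    intro u v hu hv
    refine Summable.of_nonneg_of_le (fun μ => by positivity) (fun μ => ?_)
      ((hu.mul_left 2).add (hv.mul_left 2))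
    have h1 : ‖specProj L μ (u + v)‖ ^ 2 ≤ 2 * ‖specProj L μ u‖ ^ 2 + 2 * ‖specProj L μ v‖ ^ 2 := by
      have h2 : ‖specProj L μ (u + v)‖ ≤ ‖specProj L μ u‖ + ‖specProj L μ v‖ := by
        rw [map_add]
        exact norm_add_le _ _
      nlinarith [norm_nonneg (specProj L μ (u + v)), norm_nonneg (specProj L μ u),
        norm_nonneg (specProj L μ v), sq_nonneg (‖specProj L μ u‖ - ‖specProj L μ v‖)]
    have h3 : 0 ≤ |μ| ^ k := by positivity
    nlinarith [mul_le_mul_of_nonneg_left h1 h3]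
  zero_mem' := by
    have : (fun μ : ℝ => |μ| ^ k * ‖specProj L μ (0 : H)‖ ^ 2) = fun _ => 0 := by
      funext μ
      simp
    change Summable _
    rw [this]
    exact summable_zero
  smul_mem' := by
    intro c u hu
    have : (fun μ : ℝ => |μ| ^ k * ‖specProj L μ (c • u)‖ ^ 2) =
        fun μ => ‖c‖ ^ 2 * (|μ| ^ k * ‖specProj L μ u‖ ^ 2) := by
      funext μ
      rw [map_smul, norm_smul]
      ring
    change Summable _
    rw [this]
    exact hu.mul_left _

/-- The natural scalar product `⟨L^{k/2} u, L^{k/2} v⟩` of `D(L^{k/2})`. -/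
def powInner (L : H →ₗ.[ℂ] H) (k : ℕ) (u v : H) : ℂ :=
  ∑' μ : ℝ, ((|μ| ^ k : ℝ) : ℂ) * inner ℂ (specProj L μ u) (specProj L μ v)

/-- The three factors of the `i`-th phase space are `D(L^{k/2})`, `k = expo i 0, expo i 1, expo i 2`:
`D(L^{1/2}) × D(L^{1/2}) × H`, `D(L) × D(L) × D(L^{1/2})`, `D(L) × D(L^{1/2}) × H` and
`D(L^{3/2}) × D(L) × D(L^{1/2})`. -/
def expo : Fin 4 → Fin 3 → ℕ := ![![1, 1, 0], ![2, 2, 1], ![2, 1, 0], ![3, 2, 1]]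

/-- The phase spaces. -/
def phaseSpace (L : H →ₗ.[ℂ] H) (i : Fin 4) : Submodule ℂ (H × H × H) :=
  (powDomain L (expo i 0)).prod ((powDomain L (expo i 1)).prod (powDomain L (expo i 2)))

/-- The natural scalar product of the phase space. -/
def natInner (L : H →ₗ.[ℂ] H) (i : Fin 4) (U V : phaseSpace L i) : ℂ :=
  powInner L (expo i 0) U.1.1 V.1.1 + powInner L (expo i 1) U.1.2.1 V.1.2.1 +
    powInner L (expo i 2) U.1.2.2 V.1.2.2

/-- The part of an operator `T` in a subspace `p`: all `x ∈ p ∩ D(T)` with `T x ∈ p`. -/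
def partIn {E : Type*} [AddCommGroup E] [Module ℂ E] (T : E →ₗ.[ℂ] E) (p : Submodule ℂ E) :
    p →ₗ.[ℂ] p where
  domain :=
    { carrier := {x | ∃ h : (x : E) ∈ T.domain, T ⟨x, h⟩ ∈ p}
      add_mem' := by
        rintro x y ⟨hx, hx'⟩ ⟨hy, hy'⟩
        refine ⟨T.domain.add_mem hx hy, ?_⟩
        have h := p.add_mem hx' hy'
        rw [← T.map_add] at h
        exact h
      zero_mem' := by
        refine ⟨T.domain.zero_mem, ?_⟩
        have h := p.zero_mem
        rw [← T.map_zero] at h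
        exact h
      smul_mem' := by
        rintro c x ⟨hx, hx'⟩
        refine ⟨T.domain.smul_mem c hx, ?_⟩
        have h := p.smul_mem c hx'
        rw [← T.map_smul] at h
        exact h }
  toFun :=
    { toFun := fun x => ⟨T ⟨x.1, x.2.fst⟩, x.2.snd⟩
      map_add' := fun x y => Subtype.ext (T.map_add ⟨x.1, x.2.fst⟩ ⟨y.1, y.2.fst⟩)
      map_smul' := fun c x => Subtype.ext (T.map_smul c ⟨x.1, x.2.fst⟩) }

/-- The linear map `(u, v, w) ↦ u + β v`. -/
def sumMap (H : Type*) [AddCommGroup H] [Module ℂ H] (β : ℝ) : H × H × H →ₗ[ℂ] H where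
  toFun U := U.1 + (β : ℂ) • U.2.1
  map_add' U V := by
    simp only [Prod.fst_add, Prod.snd_add, smul_add]
    abel
  map_smul' c U := by
    simp only [Prod.smul_fst, Prod.smul_snd, smul_add, RingHom.id_apply]
    rw [smul_comm c]

/-- The operator `(u, v, w) ↦ (v, w, -(1/α) L (u + β v) - (1/α) w)` in `H × H × H`, defined where
`u + β v ∈ D(L)`. -/
def formalGenerator {H : Type*} [AddCommGroup H] [Module ℂ H] (L : H →ₗ.[ℂ] H) (α β : ℝ) :
    H × H × H →ₗ.[ℂ] H × H × H where
  domain := L.domain.comap (sumMap H β)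
  toFun :=
    { toFun := fun U => (U.1.2.1, U.1.2.2,
        -((1 / α : ℝ) : ℂ) • L ⟨sumMap H β U.1, U.2⟩ - ((1 / α : ℝ) : ℂ) • U.1.2.2)
      map_add' := by
        intro U V
        have hL : L ⟨sumMap H β (U + V).1, (U + V).2⟩ =
            L ⟨sumMap H β U.1, U.2⟩ + L ⟨sumMap H β V.1, V.2⟩ := by
          rw [← L.map_add]
          exact congrArg L (Subtype.ext ((sumMap H β).map_add _ _))
        rw [hL]
        simp only [Submodule.coe_add, Prod.snd_add, Prod.fst_add, Prod.mk_add_mk, smul_add]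
        congr 2
        abel
      map_smul' := by
        intro c U
        have hL : L ⟨sumMap H β (c • U).1, (c • U).2⟩ = c • L ⟨sumMap H β U.1, U.2⟩ := by
          rw [← L.map_smul]
          exact congrArg L (Subtype.ext ((sumMap H β).map_smul _ _))
        rw [hL]
        simp only [Submodule.coe_smul, Prod.smul_fst, Prod.smul_snd, Prod.smul_mk, smul_sub,
          RingHom.id_apply]
        rw [smul_comm c, smul_comm c] }

/-- The generator `A` in the `i`-th phase space, on its natural domain: all `U = (u, v, w)` in the
phase space for which `u + β v ∈ D(L)` and `A U` lies in the phase space again. -/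
def generator (L : H →ₗ.[ℂ] H) (α β : ℝ) (i : Fin 4) : phaseSpace L i →ₗ.[ℂ] phaseSpace L i :=
  partIn (formalGenerator L α β) (phaseSpace L i)

end Operator

section ScalarProduct

/-! A scalar product on a complex vector space `X` is Mathlib's `InnerProductSpace.Core ℂ X`
(conjugate linear in the first argument); neither completeness nor a relation to another norm is
part of it. -/

variable {X : Type*} [AddCommGroup X] [Module ℂ X]

/-- `y ∈ D(A*)` and `A* y = z`, the adjoint being taken with respect to the scalar product `G`. -/
def IsAdjointValue (G : InnerProductSpace.Core ℂ X) (A : X →ₗ.[ℂ] X) (y z : X) : Prop :=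
  ∀ x : A.domain, G.inner y (A x) = G.inner z x

/-- `A` is a normal operator for the scalar product `G`: it is densely defined, `D(A) = D(A*)` and
`‖A y‖ = ‖A* y‖` on this domain. On a Hilbert space these are the closed densely defined operators
with `A* A = A A*`. -/
structure IsNormalOperator (G : InnerProductSpace.Core ℂ X) (A : X →ₗ.[ℂ] X) : Prop where
  dense : ∀ x : X, ∀ ε : ℝ, 0 < ε → ∃ y ∈ A.domain, (G.inner (x - y) (x - y)).re < ε
  domain_eq : ∀ y : X, y ∈ A.domain ↔ ∃ z, IsAdjointValue G A y z
  norm_eq : ∀ (y : A.domain) (z : X), IsAdjointValue G A y z →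
    (G.inner (A y) (A y)).re = (G.inner z z).re

/-- `A* A = A A*`, including the equality of the domains. -/
def CommutesWithAdjoint (G : InnerProductSpace.Core ℂ X) (A : X →ₗ.[ℂ] X) : Prop :=
  ∀ x z : X, (∃ h : x ∈ A.domain, IsAdjointValue G A (A ⟨x, h⟩) z) ↔
    ∃ y, IsAdjointValue G A x y ∧ ∃ h : y ∈ A.domain, A ⟨y, h⟩ = z

/-- The norm of `G` is equivalent to the norm given by the form `B`. -/
def IsEquivalentTo (G : InnerProductSpace.Core ℂ X) (B : X → X → ℂ) : Prop :=
  ∃ m M : ℝ, 0 < m ∧ 0 < M ∧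
    ∀ x : X, m * (B x x).re ≤ (G.inner x x).re ∧ (G.inner x x).re ≤ M * (B x x).re

end ScalarProduct

section Explicit

def C₁ (α β : ℝ) : ℝ := 27 - 18 * (β / α) - (β / α) ^ 2

def C₂ (α β : ℝ) : ℝ := C₁ α β ^ 2 - 64 * (β / α) ^ 3

/-- The two roots of the discriminant; they are not real if `C₂ < 0`. -/
def m₁ (α β : ℝ) : ℂ := α * (-(C₁ α β : ℂ) - (C₂ α β : ℂ) ^ (1 / 2 : ℂ)) / (8 * β ^ 3)

def m₂ (α β : ℝ) : ℂ := α * (-(C₁ α β : ℂ) + (C₂ α β : ℂ) ^ (1 / 2 : ℂ)) / (8 * β ^ 3)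

/-- `lam 0, lam 1, lam 2` are the three roots, with multiplicity, of
`α λ³ + λ² + β μ λ + μ = 0`. -/
def AreCharRoots (α β μ : ℝ) (lam : Fin 3 → ℂ) : Prop :=
  ∀ z : ℂ, α * z ^ 3 + z ^ 2 + β * μ * z + μ = α * ∏ j, (z - lam j)

/-- The natural norm of `(φ, l φ, l² φ)` in the `i`-th phase space if `φ` is a unit
eigenvector of `L` for the eigenvalue `μ`. -/
def normConst (i : Fin 4) (μ : ℝ) (l : ℂ) : ℝ :=
  √(∑ r : Fin 3, μ ^ expo i r * ‖l ^ (r : ℕ)‖ ^ 2)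

/-- The matrix with columns `(1, λ_j, λ_j²) / c_j`. -/
def eigMatrix (i : Fin 4) (μ : ℝ) (lam : Fin 3 → ℂ) : Matrix (Fin 3) (Fin 3) ℂ :=
  Matrix.of fun r j => lam j ^ (r : ℕ) / (normConst i μ (lam j) : ℂ)

/-- The matrix `(C⁻¹)ᴴ C⁻¹` of the new scalar product on the span of
`(φ, 0, 0), (0, φ, 0), (0, 0, φ)`. -/
def blockMatrix (i : Fin 4) (μ : ℝ) (lam : Fin 3 → ℂ) : Matrix (Fin 3) (Fin 3) ℂ :=
  ((eigMatrix i μ lam)⁻¹)ᴴ * (eigMatrix i μ lam)⁻¹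

variable {H : Type*} [NormedAddCommGroup H] [InnerProductSpace ℂ H]

/-- The coordinates of `U = (u, v, w)` along `φ`. -/
def coords (φ : H) (U : H × H × H) : Fin 3 → ℂ :=
  ![inner ℂ φ U.1, inner ℂ φ U.2.1, inner ℂ φ U.2.2]

/-- The vector `(φ, l φ, l² φ)` divided by its natural norm. -/
def eigVec (i : Fin 4) (μ : ℝ) (l : ℂ) (φ : H) : H × H × H :=
  ((normConst i μ l : ℂ)⁻¹) • (φ, l • φ, l ^ 2 • φ)

end Explicit

end ThirdOrderWave

end

noncomputable section

/-! ### Spectral theorem for `L` -/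

namespace ThirdOrderWave

/-! Over each eigenvector `φ n` of `L` the generator acts on three coordinates as the companion
matrix of the cubic. The vectors `(1, λ, λ²)` at its roots are eigenvectors, and they form a basis
exactly when the roots are distinct. The discriminant of the cubic is, up to the factor `-μ`, a
quadratic in `μ` with roots `m₁` and `m₂` (`discFactor_eq_zero_iff`). If these avoid the spectrum of
`L`, declaring all eigenvectors orthonormal turns `A` into multiplication by the roots on `ℓ²(ℕ ×
Fin 3)`, with its maximal domain (`IsCoordinateMap.isDiagonalizedBy`), and such an operator is
normal.

The real issue is the equivalence of norms: the changes of basis must be bounded, with their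
inverses, uniformly in `n`. Weighted by the natural norm, the eigenvector matrix has unit columns,
which settles one direction. For the other, Cramer's rule asks for a lower bound on its determinant,
a Vandermonde product divided by the normalization constants. The squared Vandermonde product is at
least a multiple of `μ³`. One root stays bounded and all roots are `O(√μ)`. With these bounds the
powers of `μ` cancel exactly for all four phase spaces (`exists_det_lower_bound`).

Conversely, at `m₁` or `m₂` there is a double root, hence a Jordan chain of length two, which a
normal operator cannot have in any scalar product (`IsNormalOperator.eq_zero_of_map_eq`). -/

/-- A real-valued function with finite sublevel sets on an infinite type can be enumerated
monotonically. -/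
theorem exists_equiv_nat_monotone {ι : Type*} [Infinite ι] (f : ι → ℝ)
    (hf : ∀ c : ℝ, {i | f i ≤ c}.Finite) : ∃ e : ℕ ≃ ι, Monotone (f ∘ e) := by
  have hc : Countable ι := by
    rw [← Set.countable_univ_iff]
    refine (Set.countable_iUnion fun n : ℕ => (hf n).countable).mono fun i _ => ?_
    obtain ⟨n, hn⟩ := exists_nat_ge (f i)
    exact Set.mem_iUnion.2 ⟨n, hn⟩
  obtain ⟨g, hg⟩ := exists_injective_nat ι
  -- Ties of `f` are broken by an injection into `ℕ`. The resulting linear order has finite initial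
  -- segments and no maximum, so it is isomorphic to `ℕ`.
  let key : ι → ℝ ×ₗ ℕ := fun i => toLex (f i, g i)
  have hkey : Function.Injective key := fun i j h => hg (congrArg Prod.snd (toLex.injective h))
  let : LinearOrder ι := LinearOrder.lift' key hkey
  have hle : ∀ i j : ι, i ≤ j → f i ≤ f j := by
    intro i j h
    have h' : key i ≤ key j := h
    rcases (Prod.Lex.le_iff).1 h' with h1 | h1
    · exact h1.le
    · exact h1.1.le
  have hfin : ∀ i : ι, (Set.Iic i).Finite := fun i => (hf (f i)).subset fun j hj => hle j i hj
  let : LocallyFiniteOrder ι := LocallyFiniteOrder.ofFiniteIcc fun a b =>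
    (hfin b).subset Set.Icc_subset_Iic_self
  obtain ⟨i₀⟩ : Nonempty ι := inferInstance
  obtain ⟨b, hbi, hb⟩ := (hfin i₀).exists_minimal ⟨i₀, le_refl i₀⟩
  let : OrderBot ι :=
    { bot := b
      bot_le := fun a => by
        by_contra h
        have h' := lt_of_not_ge h
        by_cases ha : a ≤ i₀
        · exact h (hb ha h'.le)
        · exact ha (h'.le.trans hbi) }
  let : NoMaxOrder ι := ⟨fun a => by
    by_contra! h
    exact Set.infinite_univ ((hfin a).subset fun j _ => h j)⟩
  let : SuccOrder ι := LinearLocallyFiniteOrder.succOrder ι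
  let : PredOrder ι := LinearLocallyFiniteOrder.predOrder ι
  let e : ι ≃o ℕ := orderIsoNatOfLinearSuccPredArch
  exact ⟨e.symm.toEquiv, fun m n h => hle _ _ (e.symm.monotone h)⟩

variable {H : Type*} [NormedAddCommGroup H] [InnerProductSpace ℂ H]
  {L : H →ₗ.[ℂ] H}

theorem eq_zero_of_map_eq_zero
    (hpos : ∀ x : L.domain, x ≠ 0 → 0 < (inner ℂ (L x) (x : H)).re) (x : L.domain)
    (hx : L x = 0) : x = 0 := by
  by_contra h
  simpa [hx] using hpos x h

theorem IsEigenvalue.pos {μ : ℝ} (h : IsEigenvalue L μ)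
    (hpos : ∀ x : L.domain, x ≠ 0 → 0 < (inner ℂ (L x) (x : H)).re) : 0 < μ := by
  obtain ⟨x, ⟨hx, hLx⟩, hx0⟩ := h
  have h1 := hpos ⟨x, hx⟩ (fun h => hx0 (congrArg Subtype.val h))
  rw [hLx, inner_smul_left, inner_self_eq_norm_sq_to_K] at h1
  have h2 : ((starRingEnd ℂ) (μ : ℂ) * ((‖x‖ : ℝ) : ℂ) ^ 2).re = μ * ‖x‖ ^ 2 := by
    rw [Complex.conj_ofReal, ← Complex.ofReal_pow, ← Complex.ofReal_mul, Complex.ofReal_re]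
  have h3 : 0 < μ * ‖x‖ ^ 2 := h2 ▸ h1
  exact pos_of_mul_pos_left h3 (by positivity)

/-- By Pythagoras, the images of two such orthonormal vectors are at distance at least `c`, so
infinitely many of them would have no convergent subsequence. -/
theorem finite_of_compact_of_orthonormal {ι : Type*} {K : H →L[ℂ] H} (hK : IsCompactOperator K)
    {φ : ι → H} (hφ : Orthonormal ℂ φ) {ν : ι → ℂ} (hν : ∀ i, K (φ i) = ν i • φ i) {c : ℝ}
    (hc : 0 < c) : {i | c ≤ ‖ν i‖}.Finite := by
  by_contra hinf
  have hinf' : {i | c ≤ ‖ν i‖}.Infinite := hinf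
  let g := hinf'.natEmbedding
  obtain ⟨S, hS, hS'⟩ := hK.image_closedBall_subset_compact 1
  obtain ⟨y, -, ψ, hψ, hψy⟩ := hS.tendsto_subseq
    (x := fun n => K (φ (g n))) (fun n => hS' ⟨φ (g n), by simp [hφ.1], rfl⟩)
  have hcs := hψy.cauchySeq
  rw [Metric.cauchySeq_iff'] at hcs
  obtain ⟨N, hN⟩ := hcs c hc
  have h1 := hN (N + 1) (Nat.le_succ N)
  have hne : ((g (ψ (N + 1))).1 : ι) ≠ (g (ψ N)).1 := by
    intro h
    have := hψ.injective (g.injective (Subtype.ext h))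
    omega
  simp only [Function.comp, dist_eq_norm, hν] at h1
  have hort : inner ℂ (ν (g (ψ (N + 1))).1 • φ (g (ψ (N + 1))).1)
      (ν (g (ψ N)).1 • φ (g (ψ N)).1) = 0 := by
    rw [inner_smul_left, inner_smul_right, hφ.2 hne]
    simp
  have h2 := @norm_sub_sq ℂ H _ _ _ (ν (g (ψ (N + 1))).1 • φ (g (ψ (N + 1))).1)
      (ν (g (ψ N)).1 • φ (g (ψ N)).1)
  rw [hort] at h2
  simp only [norm_smul, hφ.1, mul_one, map_zero, mul_zero, sub_zero] at h2
  have h3 : c ≤ ‖ν (g (ψ (N + 1))).1‖ := (g (ψ (N + 1))).2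
  have h4 : ‖ν (g (ψ (N + 1))).1 • φ (g (ψ (N + 1))).1 -
      ν (g (ψ N)).1 • φ (g (ψ N)).1‖ ^ 2 < c ^ 2 := by
    gcongr
  nlinarith [sq_nonneg ‖ν (g (ψ N)).1‖]

variable [CompleteSpace H]

theorem inner_map_eq_inner_map (hsa : IsSelfAdjoint L) (x y : L.domain) :
    inner ℂ (L x) (y : H) = inner ℂ (x : H) (L y) := by
  have h := L.adjoint_isFormalAdjoint hsa.dense_domain
  rw [LinearPMap.isSelfAdjoint_def.1 hsa] at h
  exact h x y

/-- A strictly positive operator with compact resolvent has a compact inverse. -/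
theorem exists_compact_inverse
    (hpos : ∀ x : L.domain, x ≠ 0 → 0 < (inner ℂ (L x) (x : H)).re)
    (hres : HasCompactResolvent L) :
    ∃ K : H →L[ℂ] H, IsCompactOperator K ∧ ∀ y : H, ∃ h : K y ∈ L.domain, L ⟨K y, h⟩ = y := by
  obtain ⟨z, R, hR, hR1, -⟩ := hres
  by_cases hz : z = 0
  · refine ⟨R, hR, fun y => ?_⟩
    obtain ⟨h, h'⟩ := hR1 y
    exact ⟨h, by simpa [hz] using h'⟩
  have hz' : -z⁻¹ ≠ 0 := neg_ne_zero.2 (inv_ne_zero hz)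
  -- Fredholm alternative: an eigenvector `v` of `R` for `-z⁻¹` would put `R v` into the trivial
  -- kernel of `L`. Otherwise `1 + z R` is invertible and, since `L R = 1 + z R`, the inverse of `L`
  -- is `R (1 + z R)⁻¹`.
  rcases hR.hasEigenvalue_or_mem_resolventSet hz' with h | h
  · exfalso
    obtain ⟨v, hv, hv0⟩ := h.exists_hasEigenvector
    rw [Module.End.mem_eigenspace_iff] at hv
    have hv' : R v = -z⁻¹ • v := hv
    obtain ⟨h1, h2⟩ := hR1 v
    have h3 : z • R v = -v := by rw [hv', smul_smul]; simp [hz]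
    rw [h3, sub_neg_eq_add, add_eq_right] at h2
    have h4 := congrArg Subtype.val (eq_zero_of_map_eq_zero hpos _ h2)
    have h5 : R v = 0 := h4
    rw [h5, smul_zero] at h3
    exact hv0 (neg_eq_zero.1 h3.symm)
  · obtain ⟨u, hu⟩ := h
    let S : H →L[ℂ] H := ((u⁻¹ : (H →L[ℂ] H)ˣ) : H →L[ℂ] H)
    refine ⟨R.comp ((-z⁻¹) • S), hR.comp_clm _, fun y => ?_⟩
    have h1 : (-z⁻¹) • S y - R (S y) = y := by
      have h2 : (u : H →L[ℂ] H) * S = 1 := u.mul_inv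
      have h3 := congrArg (fun T : H →L[ℂ] H => T y) h2
      rw [hu] at h3
      simpa [Algebra.algebraMap_eq_smul_one] using h3
    obtain ⟨h2, h3⟩ := hR1 ((-z⁻¹) • S y)
    refine ⟨h2, ?_⟩
    change L ⟨R ((-z⁻¹) • S y), h2⟩ = y
    rw [sub_eq_iff_eq_add] at h3
    rw [h3]
    conv_rhs => rw [← h1]
    rw [map_smul, smul_smul, sub_eq_add_neg]
    simp [hz]

/-- The spectral theorem for strictly positive operators with compact resolvent. -/
theorem exists_eigenbasis (hdim : ¬ FiniteDimensional ℂ H) (hsa : IsSelfAdjoint L)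
    (hpos : ∀ x : L.domain, x ≠ 0 → 0 < (inner ℂ (L x) (x : H)).re)
    (hres : HasCompactResolvent L) :
    ∃ (φ : HilbertBasis ℕ ℂ H) (μ : ℕ → ℝ), (∀ n, φ n ∈ eigenspace L (μ n)) ∧ Monotone μ ∧
      Tendsto μ atTop atTop := by
  obtain ⟨K, hK, hLK⟩ := exists_compact_inverse hpos hres
  have hKsym : (K : H →ₗ[ℂ] H).IsSymmetric := by
    intro a b
    obtain ⟨ha, ha'⟩ := hLK a
    obtain ⟨hb, hb'⟩ := hLK b
    have := inner_map_eq_inner_map hsa ⟨K a, ha⟩ ⟨K b, hb⟩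
    rw [ha', hb'] at this
    exact this.symm
  have hKinj : ∀ y, K y = 0 → y = 0 := by
    intro y hy
    obtain ⟨h, h'⟩ := hLK y
    rw [← h']
    have : (⟨K y, h⟩ : L.domain) = 0 := Subtype.ext hy
    rw [this, L.map_zero]
  have hbot : Module.End.eigenspace (K : H →ₗ[ℂ] H) 0 = ⊥ := by
    rw [Submodule.eq_bot_iff]
    intro x hx
    rw [Module.End.mem_eigenspace_iff, zero_smul] at hx
    exact hKinj x hx
  have hfd : ∀ ν : ℂ, FiniteDimensional ℂ (Module.End.eigenspace (K : H →ₗ[ℂ] H) ν) := by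
    intro ν
    by_cases hν : ν = 0
    · rw [hν, hbot]; infer_instance
    · exact ContinuousLinearMap.finite_dimensional_eigenspace hK ν hν
  -- All complex `ν` are allowed; those that are not eigenvalues contribute the empty type `Fin 0`.
  let ι := Σ ν : ℂ, Fin (Module.finrank ℂ (Module.End.eigenspace (K : H →ₗ[ℂ] H) ν))
  let v : ι → H := fun a =>
    (stdOrthonormalBasis ℂ (Module.End.eigenspace (K : H →ₗ[ℂ] H) a.1) a.2 : H)
  have hv : Orthonormal ℂ v := hKsym.orthogonalFamily_eigenspaces.orthonormal_sigma_orthonormal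
    (fun ν => (stdOrthonormalBasis ℂ (Module.End.eigenspace (K : H →ₗ[ℂ] H) ν)).orthonormal)
  have hspan : (Submodule.span ℂ (Set.range v))ᗮ = ⊥ := by
    rw [eq_bot_iff, ← ContinuousLinearMap.orthogonalComplement_iSup_eigenspaces_eq_bot hK hKsym]
    refine Submodule.orthogonal_le (iSup_le fun ν => ?_)
    intro x hx
    have h1 := (stdOrthonormalBasis ℂ (Module.End.eigenspace (K : H →ₗ[ℂ] H) ν)).sum_repr ⟨x, hx⟩
    change ((⟨x, hx⟩ : Module.End.eigenspace (K : H →ₗ[ℂ] H) ν) : H) ∈ _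
    rw [← h1]
    simp only [AddSubmonoidClass.coe_finsetSum, Submodule.coe_smul]
    exact Submodule.sum_mem _ fun j _ => Submodule.smul_mem _ _
      (Submodule.subset_span ⟨⟨ν, j⟩, rfl⟩)
  let b : HilbertBasis ι ℂ H := HilbertBasis.mkOfOrthogonalEqBot hv hspan
  have hb : ∀ a, b a = v a := fun a => congrFun (HilbertBasis.coe_mkOfOrthogonalEqBot hv hspan) a
  have hKv : ∀ a : ι, K (v a) = a.1 • v a := fun a =>
    Module.End.mem_eigenspace_iff.1
      (stdOrthonormalBasis ℂ (Module.End.eigenspace (K : H →ₗ[ℂ] H) a.1) a.2).2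
  have hv0 : ∀ a, v a ≠ 0 := fun a => hv.ne_zero a
  have hν0 : ∀ a : ι, a.1 ≠ 0 := by
    intro a h
    exact hv0 a (hKinj _ (by rw [hKv, h, zero_smul]))
  have hreal : ∀ a : ι, (starRingEnd ℂ) a.1 = a.1 := fun a =>
    hKsym.conj_eigenvalue_eq_self (Module.End.hasEigenvalue_of_hasEigenvector
      ⟨Module.End.mem_eigenspace_iff.2 (hKv a), hv0 a⟩)
  let m : ι → ℝ := fun a => (a.1⁻¹).re
  have hm : ∀ a : ι, ((m a : ℝ) : ℂ) = a.1⁻¹ := fun a =>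
    Complex.conj_eq_iff_re.1 (by rw [map_inv₀, hreal])
  have heig : ∀ a : ι, v a ∈ eigenspace L (m a) := by
    intro a
    have h1 : K (a.1⁻¹ • v a) = v a := by
      rw [map_smul, hKv, smul_smul, inv_mul_cancel₀ (hν0 a), one_smul]
    obtain ⟨h2, h3⟩ := hLK (a.1⁻¹ • v a)
    have h4 : v a ∈ L.domain := h1 ▸ h2
    refine ⟨h4, ?_⟩
    rw [hm, ← h3]
    exact congrArg L (Subtype.ext h1.symm)
  have hmpos : ∀ a, 0 < m a := fun a => IsEigenvalue.pos ⟨v a, heig a, hv0 a⟩ hpos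
  have hfin : ∀ c : ℝ, {a | m a ≤ c}.Finite := by
    intro c
    refine (finite_of_compact_of_orthonormal hK hv hKv
      (c := (max c 1)⁻¹) (by positivity)).subset fun a ha => ?_
    have h1 : ‖a.1‖ = (m a)⁻¹ := by
      have h2 : a.1 = ((m a : ℝ) : ℂ)⁻¹ := by rw [hm, inv_inv]
      rw [h2, norm_inv, Complex.norm_real, Real.norm_of_nonneg (hmpos a).le]
    change (max c 1)⁻¹ ≤ ‖a.1‖
    rw [h1]
    have ha' : m a ≤ c := ha
    exact inv_anti₀ (hmpos a) (ha'.trans (le_max_left _ _))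
  have hinf : Infinite ι := by
    by_contra h
    rw [not_infinite_iff_finite] at h
    have := Fintype.ofFinite ι
    exact hdim b.toOrthonormalBasis.toBasis.finiteDimensional_of_finite
  obtain ⟨e, he⟩ := exists_equiv_nat_monotone m hfin
  have hve : Orthonormal ℂ (v ∘ e) := hv.comp e e.injective
  have hspan' : (Submodule.span ℂ (Set.range (v ∘ e)))ᗮ = ⊥ := by
    rw [e.surjective.range_comp, hspan]
  refine ⟨HilbertBasis.mkOfOrthogonalEqBot hve hspan', m ∘ e, fun n => ?_, he, ?_⟩
  · rw [HilbertBasis.coe_mkOfOrthogonalEqBot]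
    exact heig _
  · refine tendsto_atTop_atTop_of_monotone he fun c => ?_
    obtain ⟨a, ha⟩ := (hfin c).exists_notMem
    refine ⟨e.symm a, ?_⟩
    simp only [Function.comp, Equiv.apply_symm_apply]
    exact (lt_of_not_ge ha).le

end ThirdOrderWave

/-! ### Power domains and `D(L)` in eigenbasis coordinates -/

namespace ThirdOrderWave

section HilbertBasis

variable {ι H : Type*} [NormedAddCommGroup H] [InnerProductSpace ℂ H]

theorem memℓp_two_iff {f : ι → ℂ} : Memℓp f 2 ↔ Summable fun i => ‖f i‖ ^ 2 := by
  rw [memℓp_gen_iff (by norm_num)]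
  simp

theorem hilbertBasis_ext (φ : HilbertBasis ι ℂ H) {u v : H}
    (h : ∀ n, inner ℂ (φ n) u = inner ℂ (φ n) v) : u = v := by
  apply φ.repr.injective
  ext n
  rw [φ.repr_apply_apply, φ.repr_apply_apply, h]

theorem exists_forall_inner_eq (φ : HilbertBasis ι ℂ H) {a : ι → ℂ}
    (ha : Summable fun n => ‖a n‖ ^ 2) : ∃ u : H, ∀ n, inner ℂ (φ n) u = a n := by
  refine ⟨φ.repr.symm ⟨a, memℓp_two_iff.2 ha⟩, fun n => ?_⟩
  rw [← φ.repr_apply_apply, LinearIsometryEquiv.apply_symm_apply]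

theorem summable_norm_inner_sq (φ : HilbertBasis ι ℂ H) (u : H) :
    Summable fun n => ‖inner ℂ (φ n) u‖ ^ 2 := by
  have h := memℓp_two_iff.1 (lp.memℓp (φ.repr u))
  simpa only [φ.repr_apply_apply] using h

theorem hasSum_norm_inner_sq (φ : HilbertBasis ι ℂ H) (u : H) :
    HasSum (fun n => ‖inner ℂ (φ n) u‖ ^ 2) (‖u‖ ^ 2) := by
  have h := φ.hasSum_inner_mul_inner u u
  rw [inner_self_eq_norm_sq_to_K] at h
  have h2 : (fun n => inner ℂ u (φ n) * inner ℂ (φ n) u) =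
      fun n => ((‖inner ℂ (φ n) u‖ ^ 2 : ℝ) : ℂ) := by
    funext n
    rw [← inner_conj_symm, RCLike.conj_mul]
    norm_cast
  rw [h2] at h
  refine Complex.hasSum_ofReal.1 ?_
  push_cast at h ⊢
  exact h

end HilbertBasis

/-- Summing a nonnegative function by fibres. -/
theorem hasSum_iff_of_hasSum_fiber {f : ℕ → ℝ} (hf : ∀ n, 0 ≤ f n) {μ : ℕ → ℝ} {F : ℝ → ℝ}
    (hF : ∀ c, HasSum (fun n => if μ n = c then f n else 0) (F c)) {s : ℝ} :
    HasSum F s ↔ HasSum f s := by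
  have hfib : ∀ c, HasSum (fun n : {n // μ n = c} => f n) (F c) := by
    intro c
    have h1 := hF c
    have h2 : (fun n => if μ n = c then f n else 0) = Set.indicator {n | μ n = c} f := by
      funext n
      simp [Set.indicator]
    rw [h2] at h1
    exact (hasSum_subtype_iff_indicator (s := {n | μ n = c})).2 h1
  rw [← (Equiv.sigmaFiberEquiv μ).hasSum_iff]
  -- Only this direction needs nonnegativity: summable fibre sums exclude cancellation.
  have key : Summable F → Summable (f ∘ Equiv.sigmaFiberEquiv μ) := by
    intro h
    refine (summable_sigma_of_nonneg fun x => hf _).2 ⟨fun c => (hfib c).summable, ?_⟩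
    have h3 : (fun c => ∑' n : {n // μ n = c}, (f ∘ Equiv.sigmaFiberEquiv μ) ⟨c, n⟩) = F := by
      funext c
      exact (hfib c).tsum_eq
    exact h3 ▸ h
  constructor
  · intro h
    have h1 := (key h.summable).hasSum
    have h2 := h1.sigma (g := F) fun c => hfib c
    rw [h2.unique h] at h1
    exact h1
  · intro h
    exact h.sigma fun c => hfib c

variable {H : Type*} [NormedAddCommGroup H] [InnerProductSpace ℂ H] [CompleteSpace H]
  {L : H →ₗ.[ℂ] H}

theorem inner_eq_zero_of_mem_eigenspace (hsa : IsSelfAdjoint L) {μ ν : ℝ} (h : μ ≠ ν) {x y : H}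
    (hx : x ∈ eigenspace L μ) (hy : y ∈ eigenspace L ν) : inner ℂ x y = 0 := by
  obtain ⟨hx, hx'⟩ := hx
  obtain ⟨hy, hy'⟩ := hy
  have h1 := inner_map_eq_inner_map hsa ⟨x, hx⟩ ⟨y, hy⟩
  rw [hx', hy', inner_smul_left, inner_smul_right, Complex.conj_ofReal] at h1
  have h2 : ((μ : ℂ) - ν) * inner ℂ x y = 0 := by linear_combination h1
  exact (mul_eq_zero.1 h2).resolve_left (sub_ne_zero.2 (by exact_mod_cast h))

theorem specProj_of_mem_eigenspace (hsa : IsSelfAdjoint L) {μ ν : ℝ} {x : H}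
    (hx : x ∈ eigenspace L ν) : specProj L μ x = if ν = μ then x else 0 := by
  split_ifs with h
  · subst h
    exact Submodule.starProjection_eq_self_iff.2 (Submodule.le_topologicalClosure _ hx)
  · refine Submodule.starProjection_apply_eq_zero_iff _ |>.2 ?_
    rw [Submodule.orthogonal_closure]
    intro y hy
    exact inner_eq_zero_of_mem_eigenspace hsa (Ne.symm h) hy hx

theorem inner_specProj (hsa : IsSelfAdjoint L) {μ ν : ℝ} {x : H}
    (hx : x ∈ eigenspace L ν) (u : H) :
    inner ℂ x (specProj L μ u) = if ν = μ then inner ℂ x u else 0 := by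
  have h : inner ℂ x (specProj L μ u) = inner ℂ (specProj L μ x) u :=
    (Submodule.inner_starProjection_left_eq_right _ _ _).symm
  rw [h, specProj_of_mem_eigenspace hsa hx]
  split_ifs <;> simp

/-- `φ` is a Hilbert basis of eigenvectors of the self-adjoint operator `L`, for the positive
eigenvalues `μ`. -/
structure IsEigenbasis (L : H →ₗ.[ℂ] H) (φ : HilbertBasis ℕ ℂ H) (μ : ℕ → ℝ) : Prop where
  isSelfAdjoint : IsSelfAdjoint L
  mem : ∀ n, φ n ∈ eigenspace L (μ n)
  pos : ∀ n, 0 < μ n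

namespace IsEigenbasis

variable {φ : HilbertBasis ℕ ℂ H} {μ : ℕ → ℝ}

theorem inner_map (hφ : IsEigenbasis L φ μ) (x : L.domain) (n : ℕ) :
    inner ℂ (φ n) (L x) = μ n * inner ℂ (φ n) (x : H) := by
  obtain ⟨h1, h2⟩ := hφ.mem n
  have h3 := inner_map_eq_inner_map hφ.isSelfAdjoint ⟨φ n, h1⟩ x
  rw [h2, inner_smul_left, Complex.conj_ofReal] at h3
  exact h3.symm

/-- Parseval for each spectral component: only the `φ n` with `μ n = c` see `specProj L c u`, so the
sum over real `c` regroups the sum over `n`. -/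
theorem hasSum_pow_iff (hφ : IsEigenbasis L φ μ) (k : ℕ) (u : H) {s : ℝ} :
    HasSum (fun c : ℝ => |c| ^ k * ‖specProj L c u‖ ^ 2) s ↔
      HasSum (fun n => μ n ^ k * ‖inner ℂ (φ n) u‖ ^ 2) s := by
  refine hasSum_iff_of_hasSum_fiber (μ := μ)
    (fun n => mul_nonneg (pow_nonneg (hφ.pos n).le _) (sq_nonneg _)) fun c => ?_
  have h := (hasSum_norm_inner_sq φ (specProj L c u)).mul_left (|c| ^ k)
  refine h.congr_fun fun n => ?_
  rw [inner_specProj hφ.isSelfAdjoint (hφ.mem n)]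
  split_ifs with hc
  · rw [← hc, abs_of_pos (hφ.pos n)]
  · simp

theorem mem_powDomain_iff (hφ : IsEigenbasis L φ μ) (k : ℕ) (u : H) :
    u ∈ powDomain L k ↔ Summable fun n => μ n ^ k * ‖inner ℂ (φ n) u‖ ^ 2 :=
  exists_congr fun _ => hφ.hasSum_pow_iff k u

theorem hasSum_powInner_self (hφ : IsEigenbasis L φ μ) (k : ℕ) {u : H} (hu : u ∈ powDomain L k) :
    HasSum (fun n => μ n ^ k * ‖inner ℂ (φ n) u‖ ^ 2) (powInner L k u u).re := by
  rw [← hφ.hasSum_pow_iff]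
  have hu' : Summable fun c : ℝ => |c| ^ k * ‖specProj L c u‖ ^ 2 := hu
  have h1 : powInner L k u u = ((∑' c : ℝ, |c| ^ k * ‖specProj L c u‖ ^ 2 : ℝ) : ℂ) := by
    rw [Complex.ofReal_tsum]
    refine tsum_congr fun c => ?_
    rw [inner_self_eq_norm_sq_to_K]
    push_cast
    rfl
  rw [h1, Complex.ofReal_re]
  exact hu'.hasSum

/-- The nontrivial direction uses `D(L) = D(L*)`: the vector with coefficients `μ n ⟨φ n, x⟩` serves
as the value of the adjoint at `x`. -/
theorem mem_domain_iff (hφ : IsEigenbasis L φ μ) (x : H) :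
    x ∈ L.domain ↔ Summable fun n => ‖(μ n : ℂ) * inner ℂ (φ n) x‖ ^ 2 := by
  constructor
  · intro hx
    have h := summable_norm_inner_sq φ (L ⟨x, hx⟩)
    simpa only [hφ.inner_map] using h
  · intro hx
    obtain ⟨y, hy⟩ := exists_forall_inner_eq φ hx
    rw [← LinearPMap.isSelfAdjoint_def.1 hφ.isSelfAdjoint]
    refine L.mem_adjoint_domain_of_exists x ⟨y, fun z => ?_⟩
    rw [← φ.tsum_inner_mul_inner, ← φ.tsum_inner_mul_inner]
    refine tsum_congr fun n => ?_
    rw [hφ.inner_map, ← inner_conj_symm, ← inner_conj_symm x, hy, map_mul, Complex.conj_ofReal]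
    ring

end IsEigenbasis

end ThirdOrderWave

/-! ### Multiplication operators on `ℓ²` and normality -/

namespace ThirdOrderWave

section Diagonal

variable {X ι : Type*} [AddCommGroup X] [Module ℂ X]

/-- The scalar product of `ℓ²` transported to `X`. -/
@[reducible]
def pullbackCore (T : X ≃ₗ[ℂ] lp (fun _ : ι => ℂ) 2) : InnerProductSpace.Core ℂ X where
  inner x y := inner ℂ (T x) (T y)
  conj_inner_symm x y := inner_conj_symm _ _
  re_inner_nonneg x := inner_self_nonneg
  add_left x y z := by rw [map_add, inner_add_left]
  smul_left x y r := by rw [map_smul, inner_smul_left]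
  definite x h := T.map_eq_zero_iff.1 (inner_self_eq_zero.1 h)

theorem pullbackCore_inner_self_re (T : X ≃ₗ[ℂ] lp (fun _ : ι => ℂ) 2) (x : X) :
    ((pullbackCore T).inner x x).re = ‖T x‖ ^ 2 :=
  (norm_sq_eq_re_inner (𝕜 := ℂ) (T x)).symm

theorem hasSum_norm_sq (f : lp (fun _ : ι => ℂ) 2) :
    HasSum (fun i => ‖f i‖ ^ 2) (‖f‖ ^ 2) := by
  have h := lp.hasSum_norm (p := 2) (by norm_num) f
  simpa using h

variable [DecidableEq ι] {T : X ≃ₗ[ℂ] lp (fun _ : ι => ℂ) 2} {A : X →ₗ.[ℂ] X} {lam : ι → ℂ}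

theorem exists_mem_span_norm_lt (T : X ≃ₗ[ℂ] lp (fun _ : ι => ℂ) 2) (x : X) {ε : ℝ} (hε : 0 < ε) :
    ∃ y ∈ Submodule.span ℂ (Set.range fun i => T.symm (lp.single 2 i (1 : ℂ))),
      ‖T (x - y)‖ ^ 2 < ε := by
  have h := lp.hasSum_single (p := 2) (by norm_num) (T x)
  obtain ⟨s, hs⟩ := ((Metric.tendsto_nhds.1 h) (√ε) (Real.sqrt_pos.2 hε)).exists
  refine ⟨T.symm (∑ i ∈ s, lp.single 2 i (T x i)), ?_, ?_⟩
  · rw [map_sum]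
    refine Submodule.sum_mem _ fun i _ => ?_
    have h1 : lp.single (E := fun _ : ι => ℂ) 2 i (T x i) = T x i • lp.single 2 i (1 : ℂ) := by
      rw [← lp.single_smul, smul_eq_mul, mul_one]
    rw [h1, map_smul]
    exact Submodule.smul_mem _ _ (Submodule.subset_span ⟨i, rfl⟩)
  · rw [map_sub, LinearEquiv.apply_symm_apply, ← dist_eq_norm, dist_comm]
    calc _ < √ε ^ 2 := by gcongr
      _ = ε := Real.sq_sqrt hε.le

/-- Under `T`, the operator `A` is the maximal operator of multiplication by `lam`. -/
structure IsDiagonalizedBy (A : X →ₗ.[ℂ] X) (T : X ≃ₗ[ℂ] lp (fun _ : ι => ℂ) 2) (lam : ι → ℂ) :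
    Prop where
  mem_domain_iff : ∀ x, x ∈ A.domain ↔ Summable fun i => ‖lam i * T x i‖ ^ 2
  map_apply : ∀ (x : A.domain) (i : ι), T (A x) i = lam i * T (x : X) i

namespace IsDiagonalizedBy

theorem single_mem (h : IsDiagonalizedBy A T lam) (i : ι) :
    T.symm (lp.single 2 i (1 : ℂ)) ∈ A.domain := by
  rw [h.mem_domain_iff, LinearEquiv.apply_symm_apply]
  refine summable_of_ne_finset_zero (s := {i}) fun j hj => ?_
  rw [lp.single_apply_ne _ _ _ (by simpa using hj)]
  simp

theorem map_single (h : IsDiagonalizedBy A T lam) (i : ι) :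
    A ⟨T.symm (lp.single 2 i (1 : ℂ)), h.single_mem i⟩ =
      lam i • T.symm (lp.single 2 i (1 : ℂ)) := by
  apply T.injective
  ext j
  rw [h.map_apply, map_smul, LinearEquiv.apply_symm_apply, lp.coeFn_smul, Pi.smul_apply,
    smul_eq_mul]
  by_cases hj : j = i
  · rw [hj]
  · rw [lp.single_apply_ne _ _ _ hj, mul_zero, mul_zero]

/-- Testing against the unit vectors, which lie in the domain, determines every coefficient. Thus
the adjoint is multiplication by the conjugates, and equal moduli give it the same domain. -/
theorem isAdjointValue_iff (h : IsDiagonalizedBy A T lam) (y z : X) :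
    IsAdjointValue (pullbackCore T) A y z ↔
      ∀ i, T z i = (starRingEnd ℂ) (lam i) * T y i := by
  constructor
  · intro hyz i
    have h1 : inner ℂ (T y) (T (A ⟨_, h.single_mem i⟩)) =
      inner ℂ (T z) (T (T.symm (lp.single 2 i (1 : ℂ)))) := hyz ⟨_, h.single_mem i⟩
    rw [h.map_single, map_smul, LinearEquiv.apply_symm_apply, inner_smul_right,
      lp.inner_single_right, lp.inner_single_right] at h1
    have h2 := congrArg (starRingEnd ℂ) h1
    simpa using h2.symm
  · intro hyz x
    change inner ℂ (T y) (T (A x)) = inner ℂ (T z) (T x)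
    rw [lp.inner_eq_tsum, lp.inner_eq_tsum]
    refine tsum_congr fun i => ?_
    rw [h.map_apply, hyz]
    simp only [RCLike.inner_apply, map_mul, Complex.conj_conj]
    ring

theorem mem_domain_iff_exists (h : IsDiagonalizedBy A T lam) (y : X) :
    y ∈ A.domain ↔ ∃ z, IsAdjointValue (pullbackCore T) A y z := by
  simp only [h.mem_domain_iff, h.isAdjointValue_iff]
  have h1 : ∀ i, ‖lam i * T y i‖ = ‖(starRingEnd ℂ) (lam i) * T y i‖ := by simp
  simp only [h1]
  constructor
  · intro hs
    refine ⟨T.symm ⟨_, memℓp_two_iff.2 hs⟩, fun i => ?_⟩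
    rw [LinearEquiv.apply_symm_apply]
  · rintro ⟨z, hz⟩
    simp only [← hz]
    exact (hasSum_norm_sq (T z)).summable

theorem isNormalOperator (h : IsDiagonalizedBy A T lam) :
    IsNormalOperator (pullbackCore T) A where
  dense x ε hε := by
    obtain ⟨y, hy, hxy⟩ := exists_mem_span_norm_lt T x hε
    refine ⟨y, ?_, by rwa [pullbackCore_inner_self_re]⟩
    refine Submodule.span_le.2 ?_ hy
    rintro _ ⟨i, rfl⟩
    exact h.single_mem i
  domain_eq := h.mem_domain_iff_exists
  norm_eq y z hyz := by
    rw [h.isAdjointValue_iff] at hyz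
    rw [pullbackCore_inner_self_re, pullbackCore_inner_self_re]
    refine (hasSum_norm_sq _).unique ((hasSum_norm_sq (T z)).congr_fun fun i => ?_)
    rw [h.map_apply, hyz]
    simp

/-- Both sides multiply the coefficients of `x` by `|lam i|²`. Each inner domain condition follows
because the final product, being some `T z`, is square summable, or from `D(A) = D(A*)`. -/
theorem commutesWithAdjoint (h : IsDiagonalizedBy A T lam) :
    CommutesWithAdjoint (pullbackCore T) A := by
  intro x z
  constructor
  · rintro ⟨hx, hz⟩
    obtain ⟨y, hy⟩ := (h.mem_domain_iff_exists x).1 hx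
    have hy' := (h.isAdjointValue_iff _ _).1 hy
    have hz' := (h.isAdjointValue_iff _ _).1 hz
    have h1 : ∀ i, lam i * T y i = T z i := by
      intro i
      rw [hz', hy', h.map_apply]
      ring
    have h2 : y ∈ A.domain := by
      rw [h.mem_domain_iff]
      simp only [h1]
      exact (hasSum_norm_sq (T z)).summable
    refine ⟨y, hy, h2, T.injective ?_⟩
    ext i
    rw [h.map_apply, h1]
  · rintro ⟨y, hy, hyd, rfl⟩
    have hx := (h.mem_domain_iff_exists x).2 ⟨y, hy⟩
    refine ⟨hx, (h.isAdjointValue_iff _ _).2 fun i => ?_⟩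
    rw [h.map_apply, h.map_apply, (h.isAdjointValue_iff _ _).1 hy]
    ring

end IsDiagonalizedBy

end Diagonal

/-- A normal operator has no generalized eigenvectors of rank two. -/
theorem IsNormalOperator.eq_zero_of_map_eq {X : Type*} [AddCommGroup X] [Module ℂ X]
    {G : InnerProductSpace.Core ℂ X} {A : X →ₗ.[ℂ] X} (hA : IsNormalOperator G A) {l : ℂ}
    (x y : A.domain) (hy : A y = l • (y : X)) (hx : A x = l • (x : X) + y) : (y : X) = 0 := by
  have hadd : ∀ a b c : X, G.inner a (b + c) = G.inner a b + G.inner a c :=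
    @InnerProductSpace.Core.inner_add_right ℂ X _ _ _ G.toCore
  have hsmul : ∀ (a b : X) (c : ℂ), G.inner a (c • b) = c * G.inner a b := fun a b c =>
    @InnerProductSpace.Core.inner_smul_right ℂ X _ _ _ G.toCore a b c
  obtain ⟨z, hz⟩ := (hA.domain_eq y).1 y.2
  have h1 : G.inner z y = l * G.inner y y := by rw [← hz y, hy, hsmul]
  have h2 := hA.norm_eq y z hz
  have h3 : G.inner (y : X) z = (starRingEnd ℂ) l * G.inner y y := by
    rw [← G.conj_inner_symm, h1, map_mul, G.conj_inner_symm]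
  have hre : ∀ a : X, ((G.inner a a).re : ℂ) = G.inner a a := fun a =>
    Complex.conj_eq_iff_re.1 (G.conj_inner_symm a a)
  have h4 : G.inner z z = l * (starRingEnd ℂ) l * G.inner y y := by
    rw [← hre z, ← h2, hre, hy, hsmul, G.smul_left]
    ring
  -- An eigenvector of a normal operator is an eigenvector of the adjoint for the conjugate
  -- eigenvalue: the squared norm of the difference expands to zero by `h1`, `h3`, `h4`.
  have h5 : z + (-(starRingEnd ℂ) l) • (y : X) = 0 := by
    apply G.definite
    rw [hadd, hsmul, G.add_left, G.add_left, G.smul_left, G.smul_left, h1, h3, h4]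
    simp only [map_neg, Complex.conj_conj]
    ring
  -- Pairing `y` with `A x = l x + y` gives `l ⟨y, x⟩ + ⟨y, y⟩`, while the adjoint gives `l ⟨y, x⟩`.
  have h6 := hz x
  rw [hx, hadd, hsmul, eq_neg_of_add_eq_zero_left h5, neg_smul, neg_neg, G.smul_left,
    Complex.conj_conj] at h6
  exact G.definite _ (by linear_combination h6)

end ThirdOrderWave

/-! ### The characteristic cubic, its discriminant and root bounds -/

namespace ThirdOrderWave

section Cubic

variable {α β : ℝ}

/-- The discriminant of `α λ³ + λ² + β μ λ + μ` is `-μ` times this polynomial in `μ`. -/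
def discFactor (α β μ : ℝ) : ℝ :=
  4 * α * β ^ 3 * μ ^ 2 + (27 * α ^ 2 - 18 * α * β - β ^ 2) * μ + 4

theorem discFactor_eq (hα : 0 < α) (hβ : 0 < β) (μ : ℝ) :
    (discFactor α β μ : ℂ) = 4 * α * β ^ 3 * (μ - m₁ α β) * (μ - m₂ α β) := by
  have hs : ((C₂ α β : ℂ) ^ (1 / 2 : ℂ)) ^ 2 = C₂ α β := by
    have h := Complex.cpow_nat_inv_pow (C₂ α β : ℂ) (n := 2) two_ne_zero
    rw [one_div]
    exact_mod_cast h
  have hα' : (α : ℂ) ≠ 0 := by exact_mod_cast hα.ne'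
  have hβ' : (β : ℂ) ≠ 0 := by exact_mod_cast hβ.ne'
  have h1 : (C₁ α β : ℂ) * α ^ 2 = 27 * α ^ 2 - 18 * α * β - β ^ 2 := by
    simp only [C₁]; push_cast; field_simp
  have h2 : (C₂ α β : ℂ) * α ^ 3 = C₁ α β ^ 2 * α ^ 3 - 64 * β ^ 3 := by
    simp only [C₂]; push_cast; field_simp
  simp only [m₁, m₂]
  -- Only `s ^ 2 = C₂` matters from here on, so neither the branch of the root nor the sign of `C₂`
  -- does.
  generalize (C₂ α β : ℂ) ^ (1 / 2 : ℂ) = s at hs ⊢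
  have h3 : 4 * (α : ℂ) * β ^ 3 * (μ - α * (-(C₁ α β : ℂ) - s) / (8 * β ^ 3)) *
      (μ - α * (-(C₁ α β : ℂ) + s) / (8 * β ^ 3)) =
      4 * α * β ^ 3 * μ ^ 2 + C₁ α β * α ^ 2 * μ +
        (C₁ α β ^ 2 * α ^ 3 - s ^ 2 * α ^ 3) / (16 * β ^ 3) := by
    field_simp
    ring
  rw [h3, hs, h1, h2, discFactor]
  push_cast
  field_simp
  ring

theorem discFactor_eq_zero_iff (hα : 0 < α) (hβ : 0 < β) (μ : ℝ) :
    discFactor α β μ = 0 ↔ (μ : ℂ) = m₁ α β ∨ (μ : ℂ) = m₂ α β := by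
  have hα' : (α : ℂ) ≠ 0 := by exact_mod_cast hα.ne'
  have hβ' : (β : ℂ) ≠ 0 := by exact_mod_cast hβ.ne'
  rw [← Complex.ofReal_eq_zero, discFactor_eq hα hβ]
  simp [hα', hβ', sub_eq_zero]

/-- The cubic takes values of opposite sign (or zero) at `-1/α` and `-1/β`, so a root lies between
them, whatever `μ` is. -/
theorem exists_real_root (hα : 0 < α) (hβ : 0 < β) {μ : ℝ} (hμ : 0 < μ) :
    ∃ x : ℝ, α * x ^ 3 + x ^ 2 + β * μ * x + μ = 0 ∧ |x| ≤ max (1 / α) (1 / β) := by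
  let f : ℝ → ℝ := fun x => α * x ^ 3 + x ^ 2 + β * μ * x + μ
  have hf : Continuous f := by fun_prop
  have h1 : f (-(1 / α)) = μ * (α - β) / α := by
    simp only [f]; field_simp; ring
  have h2 : f (-(1 / β)) = (β - α) / β ^ 3 := by
    simp only [f]; field_simp; ring
  have h0 : (0 : ℝ) ∈ Set.uIcc (f (-(1 / α))) (f (-(1 / β))) := by
    rw [Set.mem_uIcc, h1, h2]
    rcases le_total α β with h | h
    · left
      exact ⟨div_nonpos_of_nonpos_of_nonneg
        (mul_nonpos_of_nonneg_of_nonpos hμ.le (by linarith)) hα.le,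
        div_nonneg (by linarith) (by positivity)⟩
    · right
      exact ⟨div_nonpos_of_nonpos_of_nonneg (by linarith) (by positivity),
        div_nonneg (mul_nonneg hμ.le (by linarith)) hα.le⟩
  obtain ⟨x, hx, hfx⟩ := intermediate_value_uIcc hf.continuousOn h0
  refine ⟨x, hfx, ?_⟩
  have hα' : 0 < 1 / α := by positivity
  have hβ' : 0 < 1 / β := by positivity
  rw [abs_le]
  rcases Set.mem_uIcc.1 hx with h | h
  · exact ⟨by linarith [le_max_left (1 / α) (1 / β)], by linarith [le_max_left (1 / α) (1 / β)]⟩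
  · exact ⟨by linarith [le_max_right (1 / α) (1 / β)], by linarith [le_max_left (1 / α) (1 / β)]⟩

theorem exists_areCharRoots (hα : 0 < α) (hβ : 0 < β) {μ : ℝ} (hμ : 0 < μ) :
    ∃ lam : Fin 3 → ℂ, AreCharRoots α β μ lam ∧ ‖lam 0‖ ≤ max (1 / α) (1 / β) := by
  obtain ⟨x, hx, hxle⟩ := exists_real_root hα hβ hμ
  have hα' : (α : ℂ) ≠ 0 := by exact_mod_cast hα.ne'
  -- Dividing by `z - x` leaves `α z² + (1 + α x) z + (β μ + x (1 + α x))`; `s` is a square root of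
  -- its discriminant. The bounded root goes into slot `0`, as the determinant estimate expects.
  obtain ⟨s, hs⟩ := IsAlgClosed.exists_pow_nat_eq
    (((1 : ℂ) + α * x) ^ 2 - 4 * α * (β * μ + x * (1 + α * x))) two_pos
  have hx' : (α : ℂ) * x ^ 3 + x ^ 2 + β * μ * x + μ = 0 := by exact_mod_cast hx
  refine ⟨![x, (-(1 + α * x) + s) / (2 * α), (-(1 + α * x) - s) / (2 * α)], fun z => ?_, ?_⟩
  · rw [Fin.prod_univ_three]
    simp only [Matrix.cons_val_zero, Matrix.cons_val_one, Matrix.cons_val]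
    have h1 : (α : ℂ) * ((z - x) * (z - (-(1 + α * x) + s) / (2 * α)) *
        (z - (-(1 + α * x) - s) / (2 * α))) =
        (z - x) * ((4 * α ^ 2 * z ^ 2 + 4 * α * (1 + α * x) * z + (1 + α * x) ^ 2 - s ^ 2) /
          (4 * α)) := by
      field_simp
      ring
    rw [h1, hs]
    field_simp
    linear_combination 4 * α * hx'
  · simpa using hxle

namespace AreCharRoots

variable {μ : ℝ} {lam : Fin 3 → ℂ}

theorem vieta (h : AreCharRoots α β μ lam) :
    α * (lam 0 + lam 1 + lam 2) = -1 ∧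
    α * (lam 0 * lam 1 + lam 0 * lam 2 + lam 1 * lam 2) = β * μ ∧
    α * (lam 0 * lam 1 * lam 2) = -μ := by
  have h0 := h 0
  have h1 := h 1
  have h2 := h (-1)
  rw [Fin.prod_univ_three] at h0 h1 h2
  refine ⟨?_, ?_, ?_⟩
  · linear_combination -(1 / 2 : ℂ) * (2 * h0 - h1 - h2)
  · linear_combination -(1 / 2 : ℂ) * (h1 - h2)
  · linear_combination h0

theorem root (h : AreCharRoots α β μ lam) (j : Fin 3) :
    α * lam j ^ 3 + lam j ^ 2 + β * μ * lam j + μ = 0 := by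
  rw [h (lam j), Finset.prod_eq_zero (Finset.mem_univ j) (sub_self _), mul_zero]

theorem prod_sub_sq (h : AreCharRoots α β μ lam) :
    α ^ 4 * ((lam 1 - lam 0) * (lam 2 - lam 0) * (lam 2 - lam 1)) ^ 2 =
      ((-μ * discFactor α β μ : ℝ) : ℂ) := by
  obtain ⟨h1, h2, h3⟩ := h.vieta
  -- The classical cubic discriminant, written in the coefficients that Vieta's formulas supply.
  have key : α ^ 4 * ((lam 1 - lam 0) * (lam 2 - lam 0) * (lam 2 - lam 1)) ^ 2 =
      (α * (lam 0 + lam 1 + lam 2)) ^ 2 *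
        (α * (lam 0 * lam 1 + lam 0 * lam 2 + lam 1 * lam 2)) ^ 2
      - 4 * α * (α * (lam 0 * lam 1 + lam 0 * lam 2 + lam 1 * lam 2)) ^ 3
      - 4 * (α * (lam 0 + lam 1 + lam 2)) ^ 3 * (α * (lam 0 * lam 1 * lam 2))
      + 18 * α * (α * (lam 0 + lam 1 + lam 2)) *
        (α * (lam 0 * lam 1 + lam 0 * lam 2 + lam 1 * lam 2)) * (α * (lam 0 * lam 1 * lam 2))
      - 27 * α ^ 2 * (α * (lam 0 * lam 1 * lam 2)) ^ 2 := by
    ring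
  rw [key, h1, h2, h3, discFactor]
  push_cast
  ring

/-- At a zero of the discriminant there is a double root. -/
theorem exists_double_root (h : AreCharRoots α β μ lam) (hα : 0 < α)
    (hd : discFactor α β μ = 0) :
    ∃ l : ℂ, α * l ^ 3 + l ^ 2 + β * μ * l + μ = 0 ∧ 3 * α * l ^ 2 + 2 * l + β * μ = 0 := by
  have hα' : (α : ℂ) ≠ 0 := by exact_mod_cast hα.ne'
  have h1 := h.prod_sub_sq
  rw [hd, mul_zero, Complex.ofReal_zero, mul_eq_zero, or_iff_right (pow_ne_zero 4 hα'),
    sq_eq_zero_iff, mul_eq_zero, mul_eq_zero] at h1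
  obtain ⟨e1, e2, -⟩ := h.vieta
  -- The derivative of the cubic in terms of the roots, visibly zero at `lam j` once another root
  -- coincides with it.
  have key : ∀ j, 3 * α * lam j ^ 2 + 2 * lam j + β * μ =
      3 * α * lam j ^ 2 - 2 * (α * (lam 0 + lam 1 + lam 2)) * lam j +
        α * (lam 0 * lam 1 + lam 0 * lam 2 + lam 1 * lam 2) := by
    intro j
    rw [e1, e2]
    ring
  rcases h1 with (h1 | h1) | h1
  · refine ⟨lam 0, h.root 0, ?_⟩
    rw [key, sub_eq_zero.1 h1]
    ring
  · refine ⟨lam 0, h.root 0, ?_⟩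
    rw [key, sub_eq_zero.1 h1]
    ring
  · refine ⟨lam 1, h.root 1, ?_⟩
    rw [key, sub_eq_zero.1 h1]
    ring

end AreCharRoots

theorem norm_le_of_root (hα : 0 < α) (hβ : 0 < β) {s₀ : ℝ} (hs₀ : 0 < s₀) :
    ∃ B : ℝ, 0 < B ∧ ∀ (μ : ℝ) (l : ℂ), s₀ ^ 2 ≤ μ → α * l ^ 3 + l ^ 2 + β * μ * l + μ = 0 →
      ‖l‖ ^ 2 ≤ B * μ := by
  -- With `s = √μ` and `t = ‖l‖ > b s`, the choice of `b` gives `s < t` and `(2 + β s) t² < α t³`,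
  -- so the cubic term would outweigh the others.
  let b := max 1 ((2 / s₀ + β) / α)
  have hb1 : 1 ≤ b := le_max_left _ _
  refine ⟨b ^ 2, by positivity, fun μ l hμ hl => ?_⟩
  have hμ0 : 0 < μ := lt_of_lt_of_le (by positivity) hμ
  set s := √μ with hs
  have hs2 : s ^ 2 = μ := Real.sq_sqrt hμ0.le
  have hs0 : s₀ ≤ s := Real.le_sqrt_of_sq_le hμ
  have hspos : 0 < s := hs₀.trans_le hs0
  set t := ‖l‖ with ht
  have ht0 : 0 ≤ t := norm_nonneg l
  have h1 : α * t ^ 3 ≤ t ^ 2 + β * s ^ 2 * t + s ^ 2 := by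
    have h2 : (α : ℂ) * l ^ 3 = -(l ^ 2 + β * μ * l + μ) := by linear_combination hl
    have h3 := congrArg norm h2
    rw [norm_neg, norm_mul, norm_pow, Complex.norm_real, Real.norm_of_nonneg hα.le] at h3
    rw [ht, h3, hs2]
    refine (norm_add₃_le).trans (le_of_eq ?_)
    simp only [norm_mul, norm_pow, Complex.norm_real, Real.norm_of_nonneg hβ.le,
      Real.norm_of_nonneg hμ0.le]
  rw [← hs2, ← mul_pow]
  suffices t ≤ b * s by gcongr
  by_contra! hlt
  have hbs : 0 < b * s := by positivity
  have htpos : 0 < t := hbs.trans hlt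
  have hbα : 2 / s₀ + β ≤ α * b := by
    have := le_max_right 1 ((2 / s₀ + β) / α)
    rwa [div_le_iff₀ hα, mul_comm] at this
  have hs0' : 1 / s ≤ 1 / s₀ := one_div_le_one_div_of_le hs₀ hs0
  have h2 : 2 / s + β ≤ α * b := by
    have : 2 / s = 2 * (1 / s) := by ring
    have : 2 / s₀ = 2 * (1 / s₀) := by ring
    linarith
  have h3 : 2 + β * s ≤ α * b * s := by
    have := mul_le_mul_of_nonneg_right h2 hspos.le
    rw [add_mul, div_mul_cancel₀ _ hspos.ne'] at this
    exact this
  have hst : s < t := lt_of_le_of_lt (le_mul_of_one_le_left hspos.le hb1) hlt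
  have h4 : α * b * s * t ^ 2 < α * t ^ 3 := by
    have : α * b * s * t ^ 2 = (b * s) * (α * t ^ 2) := by ring
    rw [this]
    have : α * t ^ 3 = t * (α * t ^ 2) := by ring
    rw [this]
    gcongr
  have h5 : (2 + β * s) * t ^ 2 ≤ α * b * s * t ^ 2 := by gcongr
  have h6 : s ^ 2 ≤ t ^ 2 := by gcongr
  have h7 : β * s ^ 2 * t ≤ β * s * t ^ 2 := by
    have : β * s ^ 2 * t = β * s * t * s := by ring
    rw [this]
    have : β * s * t ^ 2 = β * s * t * t := by ring
    rw [this]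
    gcongr
  linarith

end Cubic

end ThirdOrderWave

/-! ### Uniform conditioning of the eigenvector matrices -/

namespace ThirdOrderWave

/-- Cramer's rule: adjugate entries are at most `3! = 6`. The constant is `324 = 6² · 3 · 3`, one
factor `3` from Cauchy–Schwarz and one from summing over `j`. -/
theorem sum_norm_sq_le_of_det {N : Matrix (Fin 3) (Fin 3) ℂ} (hN : ∀ r j, ‖N r j‖ ≤ 1) {δ : ℝ}
    (hδ : 0 < δ) (hdet : δ ≤ ‖N.det‖ ^ 2) (c : Fin 3 → ℂ) :
    ∑ j, ‖c j‖ ^ 2 ≤ 324 / δ * ∑ r, ‖(N *ᵥ c) r‖ ^ 2 := by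
  have hadj : ∀ j r, ‖N.adjugate j r‖ ≤ 6 := by
    intro j r
    rw [Matrix.adjugate_apply]
    have h := Matrix.det_le (A := N.updateRow r (Pi.single j 1))
      (abv := IsAbsoluteValue.toAbsoluteValue (norm : ℂ → ℝ)) (x := 1) (fun a b => by
        change ‖N.updateRow r (Pi.single j 1) a b‖ ≤ 1
        by_cases ha : a = r
        · subst ha
          rw [Matrix.updateRow_self]
          by_cases hb : b = j
          · subst hb; simp
          · simp [hb]
        · rw [Matrix.updateRow_ne ha]
          exact hN a b)
    simpa [Nat.factorial] using h
  have hc : N.adjugate *ᵥ (N *ᵥ c) = N.det • c := by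
    rw [Matrix.mulVec_mulVec, Matrix.adjugate_mul, Matrix.smul_mulVec, Matrix.one_mulVec]
  have h1 : ∀ j, ‖N.det‖ ^ 2 * ‖c j‖ ^ 2 ≤ 108 * ∑ r, ‖(N *ᵥ c) r‖ ^ 2 := by
    intro j
    have h2 := congrFun hc j
    rw [Pi.smul_apply, smul_eq_mul] at h2
    rw [← mul_pow, ← norm_mul, ← h2]
    have h3 : ‖(N.adjugate *ᵥ (N *ᵥ c)) j‖ ≤ 6 * ∑ r, ‖(N *ᵥ c) r‖ := by
      rw [Finset.mul_sum, Matrix.mulVec, dotProduct]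
      refine (norm_sum_le _ _).trans (Finset.sum_le_sum fun r _ => ?_)
      rw [norm_mul]
      exact mul_le_mul_of_nonneg_right (hadj j r) (norm_nonneg _)
    calc _ ≤ (6 * ∑ r, ‖(N *ᵥ c) r‖) ^ 2 := by gcongr
      _ = 36 * (∑ r, ‖(N *ᵥ c) r‖) ^ 2 := by ring
      _ ≤ 36 * (3 * ∑ r, ‖(N *ᵥ c) r‖ ^ 2) := by
        gcongr
        simpa using sq_sum_le_card_mul_sum_sq (s := Finset.univ) (f := fun r => ‖(N *ᵥ c) r‖)
      _ = _ := by ring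
  have h2 : δ * ∑ j, ‖c j‖ ^ 2 ≤ 324 * ∑ r, ‖(N *ᵥ c) r‖ ^ 2 := by
    rw [Finset.mul_sum]
    calc _ ≤ ∑ j : Fin 3, 108 * ∑ r, ‖(N *ᵥ c) r‖ ^ 2 :=
          Finset.sum_le_sum fun j _ =>
            (mul_le_mul_of_nonneg_right hdet (sq_nonneg _)).trans (h1 j)
      _ = _ := by simp; ring
  rw [div_mul_eq_mul_div, le_div_iff₀ hδ]
  linarith

/-- This is all that the estimates use of the four phase spaces. The first relation balances the
powers of `μ` in the determinant; the inequalities identify the dominant power in the normalization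
constants. -/
theorem expo_relations (i : Fin 4) :
    expo i 1 = expo i 2 + 1 ∧ expo i 1 ≤ expo i 0 ∧ expo i 0 ≤ expo i 2 + 2 := by
  fin_cases i <;> decide

theorem normConst_sq (i : Fin 4) {μ : ℝ} (hμ : 0 < μ) (l : ℂ) :
    normConst i μ l ^ 2 = μ ^ expo i 0 + μ ^ expo i 1 * ‖l‖ ^ 2 + μ ^ expo i 2 * ‖l‖ ^ 4 := by
  rw [normConst, Real.sq_sqrt (Finset.sum_nonneg fun r _ => by positivity), Fin.sum_univ_three]
  simp only [norm_pow, Fin.val_zero, Fin.val_one, Fin.val_two]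
  ring

theorem normConst_pos (i : Fin 4) {μ : ℝ} (hμ : 0 < μ) (l : ℂ) : 0 < normConst i μ l := by
  have h : 0 < normConst i μ l ^ 2 := by
    rw [normConst_sq i hμ]
    positivity
  exact lt_of_le_of_ne (Real.sqrt_nonneg _) fun h0 => by simp [← h0] at h

theorem sum_pow_mul_norm_eigMatrix_sq (i : Fin 4) {μ : ℝ} (hμ : 0 < μ) (lam : Fin 3 → ℂ)
    (j : Fin 3) : ∑ r, μ ^ expo i r * ‖eigMatrix i μ lam r j‖ ^ 2 = 1 := by
  have h := normConst_pos i hμ (lam j)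
  have h2 : ∀ r : Fin 3, μ ^ expo i r * ‖eigMatrix i μ lam r j‖ ^ 2 =
      μ ^ expo i r * ‖lam j ^ (r : ℕ)‖ ^ 2 / normConst i μ (lam j) ^ 2 := by
    intro r
    rw [eigMatrix, Matrix.of_apply, norm_div, Complex.norm_real, Real.norm_of_nonneg h.le]
    ring
  rw [Finset.sum_congr rfl fun r _ => h2 r, ← Finset.sum_div, div_eq_one_iff_eq (by positivity),
    normConst, Real.sq_sqrt (Finset.sum_nonneg fun r _ => by positivity)]

/-- Cauchy–Schwarz over three columns of weighted norm one; no separation of the roots is needed. -/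
theorem sum_pow_mul_norm_mulVec_sq_le (i : Fin 4) {μ : ℝ} (hμ : 0 < μ) (lam : Fin 3 → ℂ)
    (c : Fin 3 → ℂ) :
    ∑ r, μ ^ expo i r * ‖(eigMatrix i μ lam *ᵥ c) r‖ ^ 2 ≤ 3 * ∑ j, ‖c j‖ ^ 2 := by
  have h1 : ∀ r, ‖(eigMatrix i μ lam *ᵥ c) r‖ ^ 2 ≤
      3 * ∑ j, ‖eigMatrix i μ lam r j‖ ^ 2 * ‖c j‖ ^ 2 := by
    intro r
    calc _ ≤ (∑ j, ‖eigMatrix i μ lam r j‖ * ‖c j‖) ^ 2 := by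
          gcongr
          rw [Matrix.mulVec, dotProduct]
          refine (norm_sum_le _ _).trans (Finset.sum_le_sum fun j _ => ?_)
          rw [norm_mul]
      _ ≤ 3 * ∑ j, (‖eigMatrix i μ lam r j‖ * ‖c j‖) ^ 2 := by
          simpa using sq_sum_le_card_mul_sum_sq (s := Finset.univ)
            (f := fun j => ‖eigMatrix i μ lam r j‖ * ‖c j‖)
      _ = _ := by simp only [mul_pow]
  calc _ ≤ ∑ r, μ ^ expo i r * (3 * ∑ j, ‖eigMatrix i μ lam r j‖ ^ 2 * ‖c j‖ ^ 2) := by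
        gcongr with r
        exact h1 r
    _ = 3 * ∑ j, (∑ r, μ ^ expo i r * ‖eigMatrix i μ lam r j‖ ^ 2) * ‖c j‖ ^ 2 := by
        simp only [Finset.mul_sum, Finset.sum_mul]
        rw [Finset.sum_comm]
        refine Finset.sum_congr rfl fun j _ => Finset.sum_congr rfl fun r _ => ?_
        ring
    _ = _ := by
        simp only [sum_pow_mul_norm_eigMatrix_sq i hμ, one_mul]

theorem det_eigMatrix (i : Fin 4) {μ : ℝ} (hμ : 0 < μ) (lam : Fin 3 → ℂ) :
    (eigMatrix i μ lam).det =
      (lam 1 - lam 0) * (lam 2 - lam 0) * (lam 2 - lam 1) /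
        (normConst i μ (lam 0) * normConst i μ (lam 1) * normConst i μ (lam 2) : ℝ) := by
  have h : ∀ j, (normConst i μ (lam j) : ℂ) ≠ 0 := fun j => by
    exact_mod_cast (normConst_pos i hμ (lam j)).ne'
  have h0 := h 0
  have h1 := h 1
  have h2 := h 2
  rw [Matrix.det_fin_three]
  simp only [eigMatrix, Matrix.of_apply, Fin.val_zero, Fin.val_one, Fin.val_two]
  push_cast
  field_simp
  ring

theorem exists_pow_le_mul_pow {μ₀ : ℝ} (hμ₀ : 0 < μ₀) {a b : ℕ} (hab : a ≤ b) :
    ∃ D : ℝ, 0 < D ∧ ∀ μ : ℝ, μ₀ ≤ μ → μ ^ a ≤ D * μ ^ b := by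
  refine ⟨(μ₀ ^ (b - a))⁻¹, by positivity, fun μ hμ => ?_⟩
  have hμ' : 0 < μ := hμ₀.trans_le hμ
  rw [inv_mul_eq_div, le_div_iff₀ (by positivity)]
  calc μ ^ a * μ₀ ^ (b - a) ≤ μ ^ a * μ ^ (b - a) := by gcongr
    _ = μ ^ b := by rw [← pow_add, Nat.add_sub_cancel' hab]

/-- Upper bound for the normalization constants at a bounded root. -/
theorem normConst_sq_le_of_norm_le (i : Fin 4) {μ₀ : ℝ} (hμ₀ : 0 < μ₀) (ρ : ℝ) :
    ∃ D : ℝ, 0 < D ∧ ∀ (μ : ℝ) (l : ℂ), μ₀ ≤ μ → ‖l‖ ≤ ρ →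
      normConst i μ l ^ 2 ≤ D * μ ^ expo i 0 := by
  obtain ⟨h1, h2, h3⟩ := expo_relations i
  obtain ⟨D₁, hD₁, hD₁'⟩ := exists_pow_le_mul_pow hμ₀ h2
  obtain ⟨D₂, hD₂, hD₂'⟩ := exists_pow_le_mul_pow hμ₀ (show expo i 2 ≤ expo i 0 by omega)
  refine ⟨1 + D₁ * ρ ^ 2 + D₂ * ρ ^ 4, by positivity, fun μ l hμ hl => ?_⟩
  have hμ' : 0 < μ := hμ₀.trans_le hμ
  rw [normConst_sq i hμ']
  calc _ ≤ μ ^ expo i 0 + D₁ * μ ^ expo i 0 * ρ ^ 2 + D₂ * μ ^ expo i 0 * ρ ^ 4 := by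
        gcongr
        · exact hD₁' μ hμ
        · exact hD₂' μ hμ
    _ = _ := by ring

/-- Upper bound for the normalization constants at a root of size `√μ`. -/
theorem normConst_sq_le_of_norm_sq_le (i : Fin 4) {μ₀ : ℝ} (hμ₀ : 0 < μ₀) (B : ℝ) :
    ∃ D : ℝ, 0 < D ∧ ∀ (μ : ℝ) (l : ℂ), μ₀ ≤ μ → ‖l‖ ^ 2 ≤ B * μ →
      normConst i μ l ^ 2 ≤ D * μ ^ (expo i 2 + 2) := by
  obtain ⟨h1, h2, h3⟩ := expo_relations i
  obtain ⟨D₁, hD₁, hD₁'⟩ := exists_pow_le_mul_pow hμ₀ h3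
  refine ⟨D₁ + |B| + B ^ 2, by positivity, fun μ l hμ hl => ?_⟩
  have hμ' : 0 < μ := hμ₀.trans_le hμ
  have hl' : ‖l‖ ^ 2 ≤ |B| * μ := hl.trans (by gcongr; exact le_abs_self B)
  rw [normConst_sq i hμ', h1]
  calc _ = μ ^ expo i 0 + μ ^ (expo i 2 + 1) * ‖l‖ ^ 2 + μ ^ expo i 2 * (‖l‖ ^ 2) ^ 2 := by ring
    _ ≤ D₁ * μ ^ (expo i 2 + 2) + μ ^ (expo i 2 + 1) * (|B| * μ) +
        μ ^ expo i 2 * (|B| * μ) ^ 2 := by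
        gcongr
        exact hD₁' μ hμ
    _ = _ := by rw [mul_pow, sq_abs]; ring

variable {α β : ℝ} {μ : ℕ → ℝ}

/-- If the discriminant has no zero among the `μ n`, it is uniformly of order `μ n ^ 3`. -/
theorem exists_mul_sq_le_discFactor (hα : 0 < α) (hβ : 0 < β) (hμ : ∀ n, 0 < μ n)
    (hlim : Tendsto μ atTop atTop) (hne : ∀ n, discFactor α β (μ n) ≠ 0) :
    ∃ κ : ℝ, 0 < κ ∧ ∀ n, κ * μ n ^ 2 ≤ |discFactor α β (μ n)| := by
  -- The ratios are positive and tend to `4 α β³ > 0`: half the limit bounds a tail, the minimum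
  -- bounds the finitely many other terms.
  let a : ℕ → ℝ := fun n => |discFactor α β (μ n)| / μ n ^ 2
  have ha : ∀ n, 0 < a n := fun n => div_pos (abs_pos.2 (hne n)) (pow_pos (hμ n) 2)
  have hlim' : Tendsto a atTop (𝓝 |4 * α * β ^ 3|) := by
    have h1 : Tendsto (fun n => (μ n)⁻¹) atTop (𝓝 0) := hlim.inv_tendsto_atTop
    have h2 : Tendsto (fun n => |4 * α * β ^ 3 + (27 * α ^ 2 - 18 * α * β - β ^ 2) * (μ n)⁻¹ +
        4 * (μ n)⁻¹ ^ 2|) atTop (𝓝 |4 * α * β ^ 3 + (27 * α ^ 2 - 18 * α * β - β ^ 2) * 0 +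
        4 * 0 ^ 2|) :=
      ((tendsto_const_nhds.add (h1.const_mul _)).add ((h1.pow 2).const_mul _)).abs
    have h3 : |4 * α * β ^ 3 + (27 * α ^ 2 - 18 * α * β - β ^ 2) * 0 + 4 * 0 ^ 2| =
        |4 * α * β ^ 3| := by
      norm_num
    rw [h3] at h2
    refine h2.congr fun n => ?_
    have hn := (hμ n).ne'
    simp only [a]
    rw [← abs_of_pos (pow_pos (hμ n) 2), ← abs_div, discFactor]
    congr 1
    field_simp
  have hpos : 0 < |4 * α * β ^ 3| := by positivity
  obtain ⟨N, hN⟩ := eventually_atTop.1 (hlim'.eventually (lt_mem_nhds (half_lt_self hpos)))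
  let s := (Finset.range (N + 1)).inf' ⟨0, by simp⟩ a
  have hs : 0 < s := (Finset.lt_inf'_iff _).2 fun n _ => ha n
  refine ⟨min s (|4 * α * β ^ 3| / 2), by positivity, fun n => ?_⟩
  rw [← le_div_iff₀ (pow_pos (hμ n) 2)]
  rcases lt_or_ge n N with h | h
  · exact (min_le_left _ _).trans (Finset.inf'_le _ (Finset.mem_range.2 (by omega)))
  · exact (min_le_right _ _).trans (hN n h).le

/-- The discriminant bounds the squared Vandermonde product below by a multiple of `μ³`. The crude
bound `O(√μ)` suffices for two roots, but the third has to be bounded. -/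
theorem exists_det_lower_bound (hα : 0 < α) (hβ : 0 < β) (hμ : ∀ n, 0 < μ n) (hmono : Monotone μ)
    (hlim : Tendsto μ atTop atTop) (hne : ∀ n, discFactor α β (μ n) ≠ 0) {lam : ℕ → Fin 3 → ℂ}
    (hlam : ∀ n, AreCharRoots α β (μ n) (lam n)) {ρ : ℝ} (hρ : ∀ n, ‖lam n 0‖ ≤ ρ) (i : Fin 4) :
    ∃ δ : ℝ, 0 < δ ∧ ∀ n, δ ≤ μ n ^ (expo i 0 + expo i 1 + expo i 2) *
      ‖(eigMatrix i (μ n) (lam n)).det‖ ^ 2 := by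
  obtain ⟨κ, hκ, hκ'⟩ := exists_mul_sq_le_discFactor hα hβ hμ hlim hne
  obtain ⟨B, -, hB⟩ := norm_le_of_root hα hβ (Real.sqrt_pos.2 (hμ 0))
  rw [Real.sq_sqrt (hμ 0).le] at hB
  obtain ⟨D₀, hD₀, hD₀'⟩ := normConst_sq_le_of_norm_le i (hμ 0) ρ
  obtain ⟨D₁, hD₁, hD₁'⟩ := normConst_sq_le_of_norm_sq_le i (hμ 0) B
  refine ⟨κ / α ^ 4 / (D₀ * D₁ * D₁), by positivity, fun n => ?_⟩
  have hn := hμ n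
  have h0n := hmono (Nat.zero_le n)
  have hc : ∀ j, 0 < normConst i (μ n) (lam n j) := fun j => normConst_pos i hn _
  have hV : κ / α ^ 4 * μ n ^ 3 ≤ ‖(lam n 1 - lam n 0) * (lam n 2 - lam n 0) *
      (lam n 2 - lam n 1)‖ ^ 2 := by
    have h1 := congrArg norm (hlam n).prod_sub_sq
    rw [norm_mul, norm_pow, norm_pow, Complex.norm_real, Complex.norm_real, Real.norm_eq_abs,
      Real.norm_eq_abs, abs_mul, abs_neg, abs_of_pos hα, abs_of_pos hn] at h1
    rw [div_mul_eq_mul_div, div_le_iff₀ (by positivity), mul_comm _ (α ^ 4), h1]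
    calc _ = μ n * (κ * μ n ^ 2) := by ring
      _ ≤ _ := by gcongr; exact hκ' n
  -- Power count, with `k₁, k₂, k₃` the values of `expo i`: `k₁ + 2 (k₃ + 2) = k₁ + k₂ + k₃ + 3`,
  -- since `k₂ = k₃ + 1`. The extra `μ³` is cancelled by `hV`.
  have hP : normConst i (μ n) (lam n 0) ^ 2 * normConst i (μ n) (lam n 1) ^ 2 *
      normConst i (μ n) (lam n 2) ^ 2 ≤
      D₀ * D₁ * D₁ * (μ n ^ (expo i 0 + expo i 1 + expo i 2) * μ n ^ 3) := by
    calc _ ≤ (D₀ * μ n ^ expo i 0) * (D₁ * μ n ^ (expo i 2 + 2)) *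
          (D₁ * μ n ^ (expo i 2 + 2)) := by
          gcongr
          · exact hD₀' _ _ h0n (hρ n)
          · exact hD₁' _ _ h0n (hB _ _ h0n ((hlam n).root 1))
          · exact hD₁' _ _ h0n (hB _ _ h0n ((hlam n).root 2))
      _ = _ := by
          rw [(expo_relations i).1]
          ring
  rw [det_eigMatrix i hn, norm_div, Complex.norm_real, Real.norm_of_nonneg
    (mul_pos (mul_pos (hc 0) (hc 1)) (hc 2)).le, div_pow, mul_pow, mul_pow, ← mul_div_assoc,
    le_div_iff₀ (mul_pos (mul_pos (pow_pos (hc 0) 2) (pow_pos (hc 1) 2)) (pow_pos (hc 2) 2))]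
  calc _ ≤ κ / α ^ 4 / (D₀ * D₁ * D₁) *
        (D₀ * D₁ * D₁ * (μ n ^ (expo i 0 + expo i 1 + expo i 2) * μ n ^ 3)) := by gcongr
    _ = μ n ^ (expo i 0 + expo i 1 + expo i 2) * (κ / α ^ 4 * μ n ^ 3) := by
        field_simp
    _ ≤ _ := by gcongr

theorem exists_uniform_bound (hα : 0 < α) (hβ : 0 < β) (hμ : ∀ n, 0 < μ n) (hmono : Monotone μ)
    (hlim : Tendsto μ atTop atTop) (hne : ∀ n, discFactor α β (μ n) ≠ 0) {lam : ℕ → Fin 3 → ℂ}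
    (hlam : ∀ n, AreCharRoots α β (μ n) (lam n)) {ρ : ℝ} (hρ : ∀ n, ‖lam n 0‖ ≤ ρ) (i : Fin 4) :
    (∀ n, IsUnit (eigMatrix i (μ n) (lam n)).det) ∧ ∃ M : ℝ, 0 < M ∧ ∀ n (c : Fin 3 → ℂ),
      ∑ j, ‖c j‖ ^ 2 ≤
        M * ∑ r, μ n ^ expo i r * ‖(eigMatrix i (μ n) (lam n) *ᵥ c) r‖ ^ 2 := by
  obtain ⟨δ, hδ, hδ'⟩ := exists_det_lower_bound hα hβ hμ hmono hlim hne hlam hρ i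
  refine ⟨fun n => ?_, 324 / δ, by positivity, fun n c => ?_⟩
  · rw [isUnit_iff_ne_zero]
    intro h
    have := hδ' n
    rw [h] at this
    simp at this
    linarith
  -- Scaling the rows by the natural weights gives unit columns, hence entries of modulus at most
  -- one, and puts the weight into the determinant.
  · let d : Fin 3 → ℂ := fun r => (√(μ n ^ expo i r) : ℝ)
    have hd : ∀ r, ‖d r‖ ^ 2 = μ n ^ expo i r := fun r => by
      simp only [d]
      rw [Complex.norm_real, Real.norm_of_nonneg (Real.sqrt_nonneg _),
        Real.sq_sqrt (pow_nonneg (hμ n).le _)]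
    have hN : ∀ r j, ‖(Matrix.diagonal d * eigMatrix i (μ n) (lam n)) r j‖ ≤ 1 := by
      intro r j
      rw [Matrix.diagonal_mul, ← sq_le_one_iff₀ (norm_nonneg _), norm_mul, mul_pow, hd,
        ← sum_pow_mul_norm_eigMatrix_sq i (hμ n) (lam n) j]
      exact Finset.single_le_sum
        (f := fun r => μ n ^ expo i r * ‖eigMatrix i (μ n) (lam n) r j‖ ^ 2)
        (fun r _ => mul_nonneg (pow_nonneg (hμ n).le _) (sq_nonneg _)) (Finset.mem_univ r)
    have hdet : δ ≤ ‖(Matrix.diagonal d * eigMatrix i (μ n) (lam n)).det‖ ^ 2 := by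
      rw [Matrix.det_mul, Matrix.det_diagonal, norm_mul, mul_pow, Fin.prod_univ_three, norm_mul,
        norm_mul, mul_pow, mul_pow, hd, hd, hd, ← pow_add, ← pow_add]
      exact hδ' n
    refine (sum_norm_sq_le_of_det hN hδ hdet c).trans (le_of_eq ?_)
    congr 1
    refine Finset.sum_congr rfl fun r _ => ?_
    rw [← Matrix.mulVec_mulVec, Matrix.mulVec_diagonal, norm_mul, mul_pow, hd]

end ThirdOrderWave

/-! ### Diagonalization of the generator on the phase space -/

namespace ThirdOrderWave

variable {H : Type*} [NormedAddCommGroup H] [InnerProductSpace ℂ H]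

theorem coords_add (φ : H) (U V : H × H × H) :
    coords φ (U + V) = coords φ U + coords φ V := by
  funext r
  fin_cases r <;> simp [coords]

theorem coords_smul (φ : H) (c : ℂ) (U : H × H × H) : coords φ (c • U) = c • coords φ U := by
  funext r
  fin_cases r <;> simp [coords]

theorem inner_sumMap (φ : H) (β : ℝ) (U : H × H × H) :
    inner ℂ φ (sumMap H β U) = coords φ U 0 + β * coords φ U 1 := by
  change inner ℂ φ (U.1 + (β : ℂ) • U.2.1) = _
  rw [inner_add_right, inner_smul_right]
  rfl

theorem ext_coords (φ : HilbertBasis ℕ ℂ H) {U V : H × H × H}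
    (h : ∀ n, coords (φ n) U = coords (φ n) V) : U = V :=
  Prod.ext (hilbertBasis_ext φ fun n => congrFun (h n) 0)
    (Prod.ext (hilbertBasis_ext φ fun n => congrFun (h n) 1)
      (hilbertBasis_ext φ fun n => congrFun (h n) 2))

/-- The columns are eigenvectors of the companion matrix: the first two rows shift the powers of a
root, the third rewrites its cube by the cubic equation. -/
theorem eigMatrix_mulVec_mul {α β μ : ℝ} {lam : Fin 3 → ℂ} (hα : 0 < α)
    (h : AreCharRoots α β μ lam) (i : Fin 4) (c : Fin 3 → ℂ) :
    eigMatrix i μ lam *ᵥ (fun j => lam j * c j) =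
      ![(eigMatrix i μ lam *ᵥ c) 1, (eigMatrix i μ lam *ᵥ c) 2,
        -((1 / α : ℝ) : ℂ) * (μ * ((eigMatrix i μ lam *ᵥ c) 0 +
          β * (eigMatrix i μ lam *ᵥ c) 1)) - ((1 / α : ℝ) : ℂ) * (eigMatrix i μ lam *ᵥ c) 2] := by
  have hα' : (α : ℂ) ≠ 0 := by exact_mod_cast hα.ne'
  have key : ∀ j, lam j ^ 3 = -(1 / α : ℂ) * (lam j ^ 2 + β * μ * lam j + μ) := by
    intro j
    field_simp
    linear_combination h.root j
  have h0 := key 0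
  have h1 := key 1
  have h2 := key 2
  funext r
  fin_cases r
  · simp only [Matrix.mulVec, dotProduct, Fin.sum_univ_three, eigMatrix, Matrix.of_apply,
      Fin.zero_eta, Fin.val_zero, Fin.val_one, Matrix.cons_val_zero]
    ring
  · simp only [Matrix.mulVec, dotProduct, Fin.sum_univ_three, eigMatrix, Matrix.of_apply,
      Fin.mk_one, Fin.val_two, Fin.val_one, Matrix.cons_val_one, Matrix.cons_val_zero]
    ring
  · simp only [Matrix.mulVec, dotProduct, Fin.sum_univ_three, eigMatrix, Matrix.of_apply,
      Fin.reduceFinMk, Fin.val_zero, Fin.val_two, Fin.val_one, Matrix.cons_val]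
    push_cast
    linear_combination c 0 / (normConst i μ (lam 0) : ℂ) * h0 +
      c 1 / (normConst i μ (lam 1) : ℂ) * h1 + c 2 / (normConst i μ (lam 2) : ℂ) * h2

theorem star_dotProduct_blockMatrix_mulVec {i : Fin 4} {μ : ℝ} {lam : Fin 3 → ℂ}
    (hdet : IsUnit (eigMatrix i μ lam).det) (c d : Fin 3 → ℂ) :
    star (eigMatrix i μ lam *ᵥ c) ⬝ᵥ (blockMatrix i μ lam *ᵥ (eigMatrix i μ lam *ᵥ d)) =
      ∑ j, inner ℂ (c j) (d j) := by
  rw [blockMatrix, Matrix.mulVec_mulVec, Matrix.mul_assoc, Matrix.nonsing_inv_mul _ hdet,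
    Matrix.mul_one, Matrix.star_mulVec, Matrix.dotProduct_mulVec, Matrix.vecMul_vecMul,
    ← Matrix.conjTranspose_mul, Matrix.nonsing_inv_mul _ hdet, Matrix.conjTranspose_one,
    Matrix.vecMul_one]
  simp only [dotProduct, RCLike.inner_apply, Pi.star_apply, RCLike.star_def]
  exact Finset.sum_congr rfl fun j _ => mul_comm _ _

theorem coords_eigVec (φ : HilbertBasis ℕ ℂ H) (i : Fin 4) (μ : ℝ) (lam : Fin 3 → ℂ) (n m : ℕ)
    (j : Fin 3) :
    coords (φ m) (eigVec i μ (lam j) (φ n)) =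
      if m = n then eigMatrix i μ lam *ᵥ Pi.single j 1 else 0 := by
  have h : inner ℂ (φ m) (φ n) = if m = n then (1 : ℂ) else 0 :=
    orthonormal_iff_ite.1 φ.orthonormal m n
  funext r
  split_ifs with hmn
  · rw [if_pos hmn] at h
    fin_cases r <;> simp [coords, eigVec, h, eigMatrix, div_eq_inv_mul]
  · rw [if_neg hmn] at h
    fin_cases r <;> simp [coords, eigVec, h]

variable [CompleteSpace H] {L : H →ₗ.[ℂ] H} {φ : HilbertBasis ℕ ℂ H} {μ : ℕ → ℝ}

namespace IsEigenbasis

theorem mem_phaseSpace_iff (hφ : IsEigenbasis L φ μ) (i : Fin 4) (U : H × H × H) :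
    U ∈ phaseSpace L i ↔
      Summable fun n => ∑ r, μ n ^ expo i r * ‖coords (φ n) U r‖ ^ 2 := by
  have h1 : U ∈ phaseSpace L i ↔ U.1 ∈ powDomain L (expo i 0) ∧ U.2.1 ∈ powDomain L (expo i 1) ∧
    U.2.2 ∈ powDomain L (expo i 2) := Iff.rfl
  rw [h1, hφ.mem_powDomain_iff, hφ.mem_powDomain_iff, hφ.mem_powDomain_iff]
  constructor
  · rintro ⟨h0, h1, h2⟩
    simp only [Fin.sum_univ_three]
    exact (h0.add h1).add h2
  · intro h
    have h2 : ∀ r : Fin 3, Summable fun n => μ n ^ expo i r * ‖coords (φ n) U r‖ ^ 2 :=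
      fun r => h.of_nonneg_of_le
        (fun n => mul_nonneg (pow_nonneg (hφ.pos n).le _) (sq_nonneg _))
        (fun n => Finset.single_le_sum (f := fun r => μ n ^ expo i r * ‖coords (φ n) U r‖ ^ 2)
          (fun r _ => mul_nonneg (pow_nonneg (hφ.pos n).le _) (sq_nonneg _)) (Finset.mem_univ r))
    exact ⟨h2 0, h2 1, h2 2⟩

theorem hasSum_natInner_self (hφ : IsEigenbasis L φ μ) {i : Fin 4} (U : phaseSpace L i) :
    HasSum (fun n => ∑ r, μ n ^ expo i r * ‖coords (φ n) U.1 r‖ ^ 2) (natInner L i U U).re := by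
  simp only [Fin.sum_univ_three]
  rw [natInner, Complex.add_re, Complex.add_re]
  exact ((hφ.hasSum_powInner_self _ U.2.1).add (hφ.hasSum_powInner_self _ U.2.2.1)).add
    (hφ.hasSum_powInner_self _ U.2.2.2)

theorem coords_formalGenerator (hφ : IsEigenbasis L φ μ) {α β : ℝ}
    (U : (formalGenerator L α β).domain) (n : ℕ) :
    coords (φ n) (formalGenerator L α β U) =
      ![coords (φ n) U.1 1, coords (φ n) U.1 2,
        -((1 / α : ℝ) : ℂ) * (μ n * (coords (φ n) U.1 0 + β * coords (φ n) U.1 1)) -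
          ((1 / α : ℝ) : ℂ) * coords (φ n) U.1 2] := by
  have h1 : formalGenerator L α β U = (U.1.2.1, U.1.2.2,
    -((1 / α : ℝ) : ℂ) • L ⟨sumMap H β U.1, U.2⟩ - ((1 / α : ℝ) : ℂ) • U.1.2.2) := rfl
  have h2 := hφ.inner_map ⟨sumMap H β U.1, U.2⟩ n
  rw [inner_sumMap] at h2
  rw [h1]
  funext r
  fin_cases r
  · rfl
  · rfl
  · change inner ℂ (φ n) (-((1 / α : ℝ) : ℂ) • L ⟨sumMap H β U.1, U.2⟩ -
      ((1 / α : ℝ) : ℂ) • U.1.2.2) = _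
    rw [inner_sub_right, inner_smul_right, inner_smul_right, h2]
    rfl

theorem coords_generator (hφ : IsEigenbasis L φ μ) {α β : ℝ} {i : Fin 4}
    (U : (generator L α β i).domain) (n : ℕ) :
    coords (φ n) (generator L α β i U : H × H × H) =
      ![coords (φ n) U.1.1 1, coords (φ n) U.1.1 2,
        -((1 / α : ℝ) : ℂ) * (μ n * (coords (φ n) U.1.1 0 + β * coords (φ n) U.1.1 1)) -
          ((1 / α : ℝ) : ℂ) * coords (φ n) U.1.1 2] :=
  hφ.coords_formalGenerator ⟨U.1.1, U.2.fst⟩ n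

end IsEigenbasis

theorem summable_prod_fin_three {f : ℕ × Fin 3 → ℝ} (hf : ∀ p, 0 ≤ f p) :
    Summable f ↔ Summable fun n => ∑ j, f (n, j) := by
  rw [summable_prod_of_nonneg hf]
  simp only [tsum_fintype]
  exact and_iff_right fun n => (hasSum_fintype _).summable

theorem hasSum_sum_norm_sq (f : lp (fun _ : ℕ × Fin 3 => ℂ) 2) :
    HasSum (fun n => ∑ j, ‖f (n, j)‖ ^ 2) (‖f‖ ^ 2) :=
  HasSum.prod_fiberwise (hasSum_norm_sq f) fun _ => hasSum_fintype _

/-- `T` maps a vector of the phase space to its coefficients in the system of eigenvectors. -/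
def IsCoordinateMap (φ : HilbertBasis ℕ ℂ H) (μ : ℕ → ℝ) (lam : ℕ → Fin 3 → ℂ) {i : Fin 4}
    (T : phaseSpace L i ≃ₗ[ℂ] lp (fun _ : ℕ × Fin 3 => ℂ) 2) : Prop :=
  ∀ (U : phaseSpace L i) (n : ℕ),
    coords (φ n) U.1 = eigMatrix i (μ n) (lam n) *ᵥ fun j => T U (n, j)

/-- Inverting each block gives the coefficients. The bound `M` makes them square summable; the
opposite bound, with constant `3`, makes every `ℓ²` sequence come from a vector of the phase space.
-/
theorem IsEigenbasis.exists_coordinateMap (hφ : IsEigenbasis L φ μ) (hmono : Monotone μ)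
    {lam : ℕ → Fin 3 → ℂ} {i : Fin 4} (hdet : ∀ n, IsUnit (eigMatrix i (μ n) (lam n)).det) {M : ℝ}
    (hM : ∀ n (c : Fin 3 → ℂ), ∑ j, ‖c j‖ ^ 2 ≤
      M * ∑ r, μ n ^ expo i r * ‖(eigMatrix i (μ n) (lam n) *ᵥ c) r‖ ^ 2) :
    ∃ T : phaseSpace L i ≃ₗ[ℂ] lp (fun _ : ℕ × Fin 3 => ℂ) 2, IsCoordinateMap φ μ lam T := by
  let a : H × H × H → ℕ × Fin 3 → ℂ := fun U p =>
    ((eigMatrix i (μ p.1) (lam p.1))⁻¹ *ᵥ coords (φ p.1) U) p.2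
  have ha : ∀ U n, eigMatrix i (μ n) (lam n) *ᵥ (fun j => a U (n, j)) = coords (φ n) U := by
    intro U n
    change eigMatrix i (μ n) (lam n) *ᵥ ((eigMatrix i (μ n) (lam n))⁻¹ *ᵥ coords (φ n) U) = _
    rw [Matrix.mulVec_mulVec, Matrix.mul_nonsing_inv _ (hdet n), Matrix.one_mulVec]
  have hmem : ∀ U : phaseSpace L i, Memℓp (a U.1) 2 := by
    intro U
    rw [memℓp_two_iff, summable_prod_fin_three fun p => sq_nonneg _]
    refine (((hφ.mem_phaseSpace_iff i U.1).1 U.2).mul_left M).of_nonneg_of_le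
      (fun n => Finset.sum_nonneg fun j _ => sq_nonneg _) fun n => ?_
    have h := hM n fun j => a U.1 (n, j)
    rwa [ha] at h
  let T₀ : phaseSpace L i →ₗ[ℂ] lp (fun _ : ℕ × Fin 3 => ℂ) 2 :=
    { toFun := fun U => ⟨a U.1, hmem U⟩
      map_add' := fun U V => by
        ext p
        change ((eigMatrix i (μ p.1) (lam p.1))⁻¹ *ᵥ coords (φ p.1) (U.1 + V.1)) p.2 =
          a U.1 p + a V.1 p
        rw [coords_add, Matrix.mulVec_add]
        rfl
      map_smul' := fun c U => by
        ext p
        change ((eigMatrix i (μ p.1) (lam p.1))⁻¹ *ᵥ coords (φ p.1) (c • U.1)) p.2 = c * a U.1 p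
        rw [coords_smul, Matrix.mulVec_smul]
        rfl }
  have hT₀ : ∀ U n, eigMatrix i (μ n) (lam n) *ᵥ (fun j => T₀ U (n, j)) = coords (φ n) U.1 :=
    fun U n => ha U.1 n
  have hinj : Function.Injective T₀ := by
    intro U V hUV
    refine Subtype.ext (ext_coords φ fun n => ?_)
    rw [← hT₀, ← hT₀, hUV]
  have hsurj : Function.Surjective T₀ := by
    intro f
    let b : ℕ → Fin 3 → ℂ := fun n => eigMatrix i (μ n) (lam n) *ᵥ fun j => f (n, j)
    have hb : Summable fun n => ∑ r, μ n ^ expo i r * ‖b n r‖ ^ 2 := by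
      have h1 := (summable_prod_fin_three fun p => sq_nonneg _).1 (hasSum_norm_sq f).summable
      exact (h1.mul_left 3).of_nonneg_of_le
        (fun n => Finset.sum_nonneg fun r _ =>
          mul_nonneg (pow_nonneg (hφ.pos n).le _) (sq_nonneg _))
        fun n => sum_pow_mul_norm_mulVec_sq_le i (hφ.pos n) (lam n) _
    -- The weights are bounded below because `μ n ≥ μ 0 > 0`, so the three components exist in `H`.
    have hb' : ∀ r, Summable fun n => ‖b n r‖ ^ 2 := by
      intro r
      obtain ⟨D, hD, hD'⟩ := exists_pow_le_mul_pow (hφ.pos 0) (Nat.zero_le (expo i r))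
      refine (hb.mul_left D).of_nonneg_of_le (fun n => sq_nonneg _) fun n => ?_
      have h1 := hD' (μ n) (hmono (Nat.zero_le n))
      rw [pow_zero] at h1
      calc ‖b n r‖ ^ 2 ≤ D * μ n ^ expo i r * ‖b n r‖ ^ 2 :=
            le_mul_of_one_le_left (sq_nonneg _) h1
        _ = D * (μ n ^ expo i r * ‖b n r‖ ^ 2) := by ring
        _ ≤ _ := by
          gcongr
          exact Finset.single_le_sum (f := fun r => μ n ^ expo i r * ‖b n r‖ ^ 2)
            (fun r _ => mul_nonneg (pow_nonneg (hφ.pos n).le _) (sq_nonneg _)) (Finset.mem_univ r)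
    choose u hu using fun r => exists_forall_inner_eq φ (hb' r)
    have hc : ∀ n, coords (φ n) (u 0, u 1, u 2) = b n := by
      intro n
      funext r
      fin_cases r
      · exact hu 0 n
      · exact hu 1 n
      · exact hu 2 n
    refine ⟨⟨(u 0, u 1, u 2), (hφ.mem_phaseSpace_iff i _).2 (by simpa only [hc] using hb)⟩, ?_⟩
    ext p
    have h1 := hT₀ ⟨(u 0, u 1, u 2),
      (hφ.mem_phaseSpace_iff i _).2 (by simpa only [hc] using hb)⟩ p.1
    rw [hc] at h1
    exact congrFun (Matrix.mulVec_injective_of_isUnit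
      ((Matrix.isUnit_iff_isUnit_det _).2 (hdet p.1)) h1) p.2
  exact ⟨LinearEquiv.ofBijective T₀ ⟨hinj, hsurj⟩, fun U n => (hT₀ U n).symm⟩

namespace IsCoordinateMap

variable {lam : ℕ → Fin 3 → ℂ} {i : Fin 4}
  {T : phaseSpace L i ≃ₗ[ℂ] lp (fun _ : ℕ × Fin 3 => ℂ) 2}

theorem hasSum_inner (hT : IsCoordinateMap φ μ lam T)
    (hdet : ∀ n, IsUnit (eigMatrix i (μ n) (lam n)).det) (U V : phaseSpace L i) :
    HasSum (fun n => star (coords (φ n) U.1) ⬝ᵥ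
      (blockMatrix i (μ n) (lam n) *ᵥ coords (φ n) V.1)) ((pullbackCore T).inner U V) := by
  refine (HasSum.prod_fiberwise (lp.hasSum_inner (T U) (T V)) fun _ => hasSum_fintype _).congr_fun
    fun n => ?_
  rw [hT, hT, star_dotProduct_blockMatrix_mulVec (hdet n)]

theorem natInner_le (hT : IsCoordinateMap φ μ lam T) (hφ : IsEigenbasis L φ μ)
    (U : phaseSpace L i) : (natInner L i U U).re ≤ 3 * ‖T U‖ ^ 2 := by
  refine hasSum_le (fun n => ?_) (hφ.hasSum_natInner_self U) ((hasSum_sum_norm_sq (T U)).mul_left 3)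
  rw [hT]
  exact sum_pow_mul_norm_mulVec_sq_le i (hφ.pos n) (lam n) _

theorem norm_sq_le (hT : IsCoordinateMap φ μ lam T) (hφ : IsEigenbasis L φ μ) {M : ℝ}
    (hM : ∀ n (c : Fin 3 → ℂ), ∑ j, ‖c j‖ ^ 2 ≤
      M * ∑ r, μ n ^ expo i r * ‖(eigMatrix i (μ n) (lam n) *ᵥ c) r‖ ^ 2)
    (U : phaseSpace L i) : ‖T U‖ ^ 2 ≤ M * (natInner L i U U).re := by
  refine hasSum_le (fun n => ?_) (hasSum_sum_norm_sq (T U)) ((hφ.hasSum_natInner_self U).mul_left M)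
  rw [hT]
  exact hM n _

theorem isEquivalentTo (hT : IsCoordinateMap φ μ lam T) (hφ : IsEigenbasis L φ μ) {M : ℝ}
    (hM0 : 0 < M) (hM : ∀ n (c : Fin 3 → ℂ), ∑ j, ‖c j‖ ^ 2 ≤
      M * ∑ r, μ n ^ expo i r * ‖(eigMatrix i (μ n) (lam n) *ᵥ c) r‖ ^ 2) :
    IsEquivalentTo (pullbackCore T) (natInner L i) := by
  refine ⟨1 / 3, M, by norm_num, hM0, fun U => ?_⟩
  rw [pullbackCore_inner_self_re]
  exact ⟨by linarith [hT.natInner_le hφ U], hT.norm_sq_le hφ hM U⟩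

theorem symm_single (hT : IsCoordinateMap φ μ lam T) (n : ℕ) (j : Fin 3) :
    (T.symm (lp.single 2 (n, j) (1 : ℂ)) : H × H × H) = eigVec i (μ n) (lam n j) (φ n) := by
  refine ext_coords φ fun m => ?_
  rw [hT, coords_eigVec, LinearEquiv.apply_symm_apply]
  split_ifs with h
  · subst h
    congr 1
    funext k
    rw [lp.single_apply, Pi.single_apply, Pi.single_apply]
    simp
  · have : (fun k => lp.single (E := fun _ : ℕ × Fin 3 => ℂ) 2 (n, j) (1 : ℂ) (m, k)) = 0 := by
      funext k
      exact lp.single_apply_ne _ _ _ (by simp [h])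
    rw [this, Matrix.mulVec_zero]

/-- For maximality of the domain, a square summable `lam * T U` defines some `W` in the phase space.
Its third component shows that `μ n ⟨φ n, u + β v⟩` are the coefficients of `-α W₃ - w`, a vector of
`H`; hence `u + β v ∈ D(L)` and `A U = W`. -/
theorem isDiagonalizedBy (hT : IsCoordinateMap φ μ lam T) (hφ : IsEigenbasis L φ μ)
    (hdet : ∀ n, IsUnit (eigMatrix i (μ n) (lam n)).det) {α β : ℝ} (hα : 0 < α)
    (hlam : ∀ n, AreCharRoots α β (μ n) (lam n)) :
    IsDiagonalizedBy (generator L α β i) T (fun p => lam p.1 p.2) := by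
  have hmap : ∀ (U : (generator L α β i).domain) (p : ℕ × Fin 3),
      T (generator L α β i U) p = lam p.1 p.2 * T (U : phaseSpace L i) p := by
    intro U p
    have h1 := hφ.coords_generator U p.1
    rw [hT, hT U.1, ← eigMatrix_mulVec_mul hα (hlam p.1)] at h1
    exact congrFun (Matrix.mulVec_injective_of_isUnit
      ((Matrix.isUnit_iff_isUnit_det _).2 (hdet p.1)) h1) p.2
  refine ⟨fun U => ⟨fun hU => ?_, fun hU => ?_⟩, hmap⟩
  · have h1 := (hasSum_norm_sq (T (generator L α β i ⟨U, hU⟩))).summable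
    simpa only [hmap] using h1
  · let W : phaseSpace L i := T.symm ⟨_, memℓp_two_iff.2 hU⟩
    have hW : ∀ n, coords (φ n) W.1 =
        ![coords (φ n) U.1 1, coords (φ n) U.1 2,
        -((1 / α : ℝ) : ℂ) * (μ n * (coords (φ n) U.1 0 + β * coords (φ n) U.1 1)) -
          ((1 / α : ℝ) : ℂ) * coords (φ n) U.1 2] := by
      intro n
      rw [hT, hT U, ← eigMatrix_mulVec_mul hα (hlam n), LinearEquiv.apply_symm_apply]
    have hα' : (α : ℂ) ≠ 0 := by exact_mod_cast hα.ne'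
    have h1 : ∀ n, (μ n : ℂ) * inner ℂ (φ n) (sumMap H β U.1) =
        inner ℂ (φ n) (-(α : ℂ) • W.1.2.2 - U.1.2.2) := by
      intro n
      have h2 : inner ℂ (φ n) W.1.2.2 = _ := congrFun (hW n) 2
      rw [inner_sub_right, inner_smul_right, h2, inner_sumMap]
      simp only [coords, Matrix.cons_val, Matrix.cons_val_zero, Matrix.cons_val_one]
      push_cast
      field_simp
      ring
    have hdom : sumMap H β U.1 ∈ L.domain := by
      rw [hφ.mem_domain_iff]
      simp only [h1]
      exact summable_norm_inner_sq φ _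
    have hval : formalGenerator L α β ⟨U.1, hdom⟩ = W.1 :=
      ext_coords φ fun n => by rw [hφ.coords_formalGenerator, hW]
    exact ⟨hdom, hval ▸ W.2⟩

end IsCoordinateMap

end ThirdOrderWave

/-! ### The Jordan chain at a double root -/

namespace ThirdOrderWave

variable {H : Type*} [NormedAddCommGroup H] [InnerProductSpace ℂ H] [CompleteSpace H]
  {L : H →ₗ.[ℂ] H}

theorem mem_powDomain_of_mem_eigenspace (hsa : IsSelfAdjoint L) {μ : ℝ} {x : H}
    (hx : x ∈ eigenspace L μ) (k : ℕ) : x ∈ powDomain L k := by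
  refine summable_of_ne_finset_zero (s := {μ}) fun c hc => ?_
  rw [specProj_of_mem_eigenspace hsa hx, if_neg (fun h => hc (by simp [h]))]
  simp

/-- The action of the generator on the span of `(x, 0, 0), (0, x, 0), (0, 0, x)` for an
eigenvector `x` of `L`. -/
theorem exists_generator_apply (hsa : IsSelfAdjoint L) {μ : ℝ} {x : H}
    (hx : x ∈ eigenspace L μ) (α β : ℝ) (i : Fin 4) (a b c : ℂ) :
    ∃ U : (generator L α β i).domain, (U.1 : H × H × H) = (a • x, b • x, c • x) ∧
      (generator L α β i U : H × H × H) = (b • x, c • x,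
        (-((1 / α : ℝ) : ℂ) * (μ * (a + β * b)) - ((1 / α : ℝ) : ℂ) * c) • x) := by
  have hmem : ∀ a b c : ℂ, (a • x, b • x, c • x) ∈ phaseSpace L i := fun a b c =>
    ⟨Submodule.smul_mem _ _ (mem_powDomain_of_mem_eigenspace hsa hx _),
      Submodule.smul_mem _ _ (mem_powDomain_of_mem_eigenspace hsa hx _),
      Submodule.smul_mem _ _ (mem_powDomain_of_mem_eigenspace hsa hx _)⟩
  have hs : sumMap H β (a • x, b • x, c • x) = (a + β * b) • x := by
    change a • x + (β : ℂ) • b • x = _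
    rw [add_smul, mul_smul]
  have hs2 : sumMap H β (a • x, b • x, c • x) ∈ eigenspace L μ := by
    rw [hs]
    exact Submodule.smul_mem _ _ hx
  obtain ⟨hdom, hL⟩ := hs2
  have hval : formalGenerator L α β ⟨(a • x, b • x, c • x), hdom⟩ = (b • x, c • x,
      (-((1 / α : ℝ) : ℂ) * (μ * (a + β * b)) - ((1 / α : ℝ) : ℂ) * c) • x) := by
    change (b • x, c • x, -((1 / α : ℝ) : ℂ) • L ⟨sumMap H β (a • x, b • x, c • x), hdom⟩ -
      ((1 / α : ℝ) : ℂ) • c • x) = _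
    rw [hL, hs, sub_smul, mul_smul, mul_smul, mul_smul]
  exact ⟨⟨⟨_, hmem a b c⟩, hdom, hval ▸ hmem _ _ _⟩, rfl, hval⟩

theorem not_isNormalOperator_generator (hsa : IsSelfAdjoint L) {α β μ : ℝ} (hα : 0 < α)
    (hβ : 0 < β) (hμ : 0 < μ) (heig : IsEigenvalue L μ) (hd : discFactor α β μ = 0) (i : Fin 4)
    (G : InnerProductSpace.Core ℂ (phaseSpace L i)) :
    ¬ IsNormalOperator G (generator L α β i) := by
  intro hN
  obtain ⟨x, hx, hx0⟩ := heig
  obtain ⟨lam, hlam, -⟩ := exists_areCharRoots hα hβ hμ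
  obtain ⟨l, hl, hl2⟩ := hlam.exists_double_root hα hd
  have hαc : (α : ℂ) ≠ 0 := by exact_mod_cast hα.ne'
  -- `(0, 1, 2l)` is the derivative in `l` of the eigenvector `(1, l, l²)`; as the derivative of the
  -- cubic also vanishes at `l`, this gives `A U = l U + V`.
  obtain ⟨U, hU, hAU⟩ := exists_generator_apply hsa hx α β i 0 1 (2 * l)
  obtain ⟨V, hV, hAV⟩ := exists_generator_apply hsa hx α β i 1 l (l ^ 2)
  have h1 : -((1 / α : ℝ) : ℂ) * (μ * (1 + β * l)) - ((1 / α : ℝ) : ℂ) * l ^ 2 = l ^ 3 := by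
    push_cast
    field_simp
    linear_combination -hl
  have h2 : -((1 / α : ℝ) : ℂ) * (μ * (0 + β * 1)) - ((1 / α : ℝ) : ℂ) * (2 * l) =
      3 * l ^ 2 := by
    push_cast
    field_simp
    linear_combination -hl2
  have h3 := hN.eq_zero_of_map_eq (l := l) U V
    (Subtype.ext (by
      change (generator L α β i V : H × H × H) = l • (V.1 : H × H × H)
      rw [hAV, hV, h1]
      simp only [Prod.smul_mk, smul_smul, mul_one]
      ring_nf))
    (Subtype.ext (by
      change (generator L α β i U : H × H × H) = l • (U.1 : H × H × H) + (V.1 : H × H × H)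
      rw [hAU, hU, hV, h2]
      simp only [Prod.smul_mk, smul_smul, Prod.mk_add_mk, ← add_smul]
      ring_nf))
  have h4 : (V.1 : H × H × H) = 0 := congrArg Subtype.val h3
  rw [hV] at h4
  have h5 : (1 : ℂ) • x = 0 := congrArg Prod.fst h4
  exact hx0 (by simpa using h5)

end ThirdOrderWave

end

/-! ### The main theorem -/

open ThirdOrderWave in
theorem theorem1 {H : Type*} [NormedAddCommGroup H] [InnerProductSpace ℂ H] [CompleteSpace H]
    (hdim : ¬ FiniteDimensional ℂ H)
    (L : H →ₗ.[ℂ] H) (hsa : IsSelfAdjoint L)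
    (hpos : ∀ x : L.domain, x ≠ 0 → 0 < (inner ℂ (L x) (x : H)).re)
    (hres : HasCompactResolvent L)
    (α β : ℝ) (hα : 0 < α) (hβ : 0 < β) :
    ((∀ μ : ℝ, IsEigenvalue L μ → (μ : ℂ) ≠ m₁ α β ∧ (μ : ℂ) ≠ m₂ α β) →
      ∃ (φ : HilbertBasis ℕ ℂ H) (μ : ℕ → ℝ) (lam : ℕ → Fin 3 → ℂ),
        (∀ n, φ n ∈ eigenspace L (μ n)) ∧ (∀ n, 0 < μ n) ∧ Monotone μ ∧
        Filter.Tendsto μ Filter.atTop Filter.atTop ∧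
        (∀ n, AreCharRoots α β (μ n) (lam n)) ∧
        ∀ i : Fin 4, ∃ G : InnerProductSpace.Core ℂ (phaseSpace L i),
          (∀ U V : phaseSpace L i,
            HasSum (fun n => star (coords (φ n) U.1) ⬝ᵥ
              (blockMatrix i (μ n) (lam n) *ᵥ coords (φ n) V.1)) (G.inner U V)) ∧
          IsEquivalentTo G (natInner L i) ∧
          IsNormalOperator G (generator L α β i) ∧
          CommutesWithAdjoint G (generator L α β i) ∧
          ∃ Ψ : ℕ → Fin 3 → phaseSpace L i,
            (∀ n j, (Ψ n j : H × H × H) = eigVec i (μ n) (lam n j) (φ n)) ∧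
            (∀ n j, ∃ h : Ψ n j ∈ (generator L α β i).domain,
              generator L α β i ⟨Ψ n j, h⟩ = lam n j • Ψ n j) ∧
            (∀ n j n' j', G.inner (Ψ n j) (Ψ n' j') = if n = n' ∧ j = j' then 1 else 0) ∧
            (∀ U : phaseSpace L i, ∀ ε : ℝ, 0 < ε →
              ∃ V ∈ Submodule.span ℂ (Set.range fun p : ℕ × Fin 3 => Ψ p.1 p.2),
                (natInner L i (U - V) (U - V)).re < ε)) ∧
    ((∃ μ : ℝ, IsEigenvalue L μ ∧ ((μ : ℂ) = m₁ α β ∨ (μ : ℂ) = m₂ α β)) →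
      ∀ (i : Fin 4) (G : InnerProductSpace.Core ℂ (phaseSpace L i)),
        ¬ IsNormalOperator G (generator L α β i)) := by
  refine ⟨fun hne => ?_, fun ⟨μ, hμ, hm⟩ i G => not_isNormalOperator_generator hsa hα hβ
    (hμ.pos hpos) hμ ((discFactor_eq_zero_iff hα hβ μ).2 hm) i G⟩
  obtain ⟨φ, μ, hφ, hmono, hlim⟩ := exists_eigenbasis hdim hsa hpos hres
  have heig : ∀ n, IsEigenvalue L (μ n) := fun n => ⟨φ n, hφ n, φ.orthonormal.ne_zero n⟩
  have hμ : ∀ n, 0 < μ n := fun n => (heig n).pos hpos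
  have hdisc : ∀ n, discFactor α β (μ n) ≠ 0 := fun n h =>
    ((discFactor_eq_zero_iff hα hβ _).1 h).elim (hne _ (heig n)).1 (hne _ (heig n)).2
  choose lam hlam hρ using fun n => exists_areCharRoots hα hβ (hμ n)
  have hbasis : IsEigenbasis L φ μ := ⟨hsa, hφ, hμ⟩
  refine ⟨φ, μ, lam, hφ, hμ, hmono, hlim, hlam, fun i => ?_⟩
  obtain ⟨hdet, M, hM0, hM⟩ := exists_uniform_bound hα hβ hμ hmono hlim hdisc hlam hρ i
  obtain ⟨T, hT⟩ := hbasis.exists_coordinateMap hmono hdet hM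
  have hA := hT.isDiagonalizedBy hbasis hdet hα hlam
  refine ⟨pullbackCore T, hT.hasSum_inner hdet, hT.isEquivalentTo hbasis hM0 hM,
    hA.isNormalOperator, hA.commutesWithAdjoint,
    fun n j => T.symm (lp.single 2 (n, j) (1 : ℂ)), hT.symm_single,
    fun n j => ⟨hA.single_mem (n, j), hA.map_single (n, j)⟩, fun n j n' j' => ?_,
    fun U ε hε => ?_⟩
  · change inner ℂ (T (T.symm _)) (T (T.symm _)) = _
    rw [LinearEquiv.apply_symm_apply, LinearEquiv.apply_symm_apply, lp.inner_single_left,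
      lp.single_apply, Pi.single_apply]
    simp only [Prod.mk.injEq, RCLike.inner_apply, map_one, mul_one]
  -- Completeness is asked in the natural norm, whose square is at most `3` times that of the new
  -- one.
  · obtain ⟨V, hV, hUV⟩ := exists_mem_span_norm_lt T U (ε := ε / 3) (by positivity)
    refine ⟨V, hV, lt_of_le_of_lt (hT.natInner_le hbasis _) ?_⟩
    linarith
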